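/- Let $\mathfrak E$ be a complex Hilbert space and let $\Theta:\mathbb D\to\mathcal L(\mathfrak E)$ be a contractive analytic function on the open unit disk, that is, $\Theta$ is analytic and $\|\Theta(z)\|\le 1$ for $|z|<1$; write $\Theta(z)=\sum_{k\ge 0}z^k\Theta_k$. For a Hilbert space $\mathfrak F$ let $H^2(\mathfrak F)$ be the Hilbert space of square summable power series with coefficients in $\mathfrak F$, and $L^2(\mathfrak F)$ the Hilbert space of square summable Laurent series $\sum_{n\in\mathbb Z}\zeta^n f_n$ with coefficients in $\mathfrak F$, so that $H^2(\mathfrak F)\subset L^2(\mathfrak F)$. Let $T_\Theta$ be multiplication by $\Theta$ on $H^2(\mathfrak E)$, let $L_\Theta$ be the Laurent operator, i.e. multiplication by $\sum_k\zeta^k\Theta_k$, on $L^2(\mathfrak E)$, let $D=(I-L_\Theta^*L_\Theta)^{1/2}$, and let $\mathfrak D=(DL^2(\mathfrak E))^-$, which is invariant under multiplication by $\zeta$. (When $\mathfrak E$ is separable and $L^2(\mathfrak E)$ is viewed as a space of functions on the unit circle, $D$ is multiplication by $\Delta(\zeta)=(I-\Theta(\zeta)^*\Theta(\zeta))^{1/2}$,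 where $\Theta(\zeta)$ is the strong radial limit.) The model $\mathbb W(\Theta)=(W_0,W_1)$ is the pair of operators on $$\mathfrak K=H^2(\mathfrak E)\oplus H^2(\mathfrak D)$$ given, for $f\in H^2(\mathfrak E)$ and $g=\sum_{n\ge0}w^ng_n\in H^2(\mathfrak D)$, by $$W_0(f\oplus g)=zf\oplus\sum_{n\ge0}w^n\,(\zeta g_n),\qquad W_1(f\oplus g)=T_\Theta f\oplus\Bigl(Df+\sum_{n\ge0}w^{n+1}g_n\Bigr).$$ A closed subspace $\mathfrak M$ is reducing for a family of operators if both $\mathfrak M$ and $\mathfrak M^\perp$ are invariant for every member of the family. The pair $(W_0,W_1)$ is called $\{1\}$-pure if there is no nonzero reducing subspace $\mathfrak M$ for $(W_0,W_1)$ such that $W_1|\mathfrak M$ is unitary. An operator $T$ is called completely nonunitary if there is no nonzero reducing subspace $\mathfrak M$ for $T$ such that $T|\mathfrak M$ is unitary. Then: (1) $W_1$ is unitary if and only if $\Theta(z)=\Theta(0)$ for all $z\in\mathbb D$ and $\Theta(0)$ is a unitary operator in $\mathcal L(\mathfrak E)$. (2) $\mathbb W(\Theta)$ is $\{1\}$-pure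 if and only if the contraction $\Theta(0)$ is completely nonunitary. -/

import Mathlib

open scoped InnerProductSpace

namespace BiIsometry

set_option linter.unusedSectionVars false

section Families

variable {H : Type*} [NormedAddCommGroup H] [InnerProductSpace ℂ H] {I : Type*}

/-- `M` is a (closed) reducing subspace for the family `V`: both `M` and its orthogonal
complement are invariant for every `V i`. -/
structure IsReducing (V : I → H →L[ℂ] H) (M : Submodule ℂ H) : Prop where
  isClosed : IsClosed (M : Set H)
  invariant : ∀ i, ∀ x ∈ M, V i x ∈ M
  invariant_orthogonal : ∀ i, ∀ x ∈ Mᗮ, V i x ∈ Mᗮ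

/-- The restriction `V|M` of a family to a reducing subspace. -/
def IsReducing.restrict {V : I → H →L[ℂ] H} {M : Submodule ℂ H} (hM : IsReducing V M) :
    I → M →L[ℂ] M :=
  fun i => (V i).restrict (hM.invariant i)

/-- The family `V` is `J`-unitary: `V j` is a unitary operator for every `j ∈ J`. -/
def IsUnitaryOn [CompleteSpace H] (J : Set I) (V : I → H →L[ℂ] H) : Prop :=
  ∀ j ∈ J, V j ∈ unitary (H →L[ℂ] H)

/-- The family `V` is `J`-pure: it has no `J`-unitary direct summand on a nonzero space. -/
def IsPure [CompleteSpace H] (J : Set I) (V : I → H →L[ℂ] H) : Prop :=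
  ∀ (M : Submodule ℂ H) (hM : IsReducing V M), M ≠ ⊥ →
    haveI : CompleteSpace M := hM.isClosed.completeSpace_coe
    ¬ IsUnitaryOn J hM.restrict

/-- A single operator is completely nonunitary: it has no unitary direct summand on a nonzero
space. -/
def IsCompletelyNonunitary [CompleteSpace H] (T : H →L[ℂ] H) : Prop :=
  IsPure Set.univ (fun _ : Unit => T)

end Families

section Coefficients

variable {E : Type*} [NormedAddCommGroup E] [InnerProductSpace ℂ E]

/-- A contractive analytic function on the unit disk with values in the bounded operators
on `E`. Values outside the open unit disk are irrelevant. -/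
structure IsContractiveAnalytic (Θ : ℂ → E →L[ℂ] E) : Prop where
  differentiableOn : DifferentiableOn ℂ Θ (Metric.ball 0 1)
  norm_le_one : ∀ z ∈ Metric.ball (0 : ℂ) 1, ‖Θ z‖ ≤ 1

/-- The Taylor coefficients `Θ_k` of `Θ` at the origin, so `Θ(z) = ∑ z ^ k Θ_k`. -/
noncomputable def coeff (Θ : ℂ → E →L[ℂ] E) (k : ℕ) : E →L[ℂ] E :=
  ((k.factorial : ℂ)⁻¹) • iteratedDeriv k Θ 0

theorem sum_root_orthogonal {L : ℕ} {ω : ℂ} (hω : IsPrimitiveRoot ω L) (hL : L ≠ 0) {n m : ℕ}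
    (hn : n < L) (hm : m < L) :
    ∑ j ∈ Finset.range L, (starRingEnd ℂ) (ω ^ (j * n)) * ω ^ (j * m) =
      if n = m then (L : ℂ) else 0 := by
  have hnorm : ‖ω‖ = 1 := hω.norm'_eq_one hL
  have hω0 : ω ≠ 0 := hω.ne_zero hL
  have hc : (starRingEnd ℂ) ω = ω⁻¹ := (Complex.inv_eq_conj hnorm).symm
  have h1 : ∀ j, (starRingEnd ℂ) (ω ^ (j * n)) * ω ^ (j * m) = (ω⁻¹ ^ n * ω ^ m) ^ j := by
    intro j
    rw [map_pow, hc, mul_pow, ← pow_mul, ← pow_mul, mul_comm n j, mul_comm m j]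
  simp only [h1]
  split_ifs with h
  · subst h
    simp [hω0]
  · have hne : ω⁻¹ ^ n * ω ^ m ≠ 1 := by
      intro h2
      apply h
      rw [inv_pow, inv_mul_eq_one₀ (pow_ne_zero _ hω0)] at h2
      exact hω.pow_inj hn hm h2
    have hp : (ω⁻¹ ^ n * ω ^ m) ^ L = 1 := by
      rw [mul_pow, ← pow_mul, ← pow_mul, mul_comm n, mul_comm m, pow_mul, pow_mul, inv_pow,
        hω.pow_eq_one]
      simp
    rw [geom_sum_eq hne, hp]
    simp

theorem discrete_parseval {L : ℕ} {ω : ℂ} (hω : IsPrimitiveRoot ω L) (hL : L ≠ 0) (c : ℕ → E) :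
    ∑ j ∈ Finset.range L, ‖∑ n ∈ Finset.range L, ω ^ (j * n) • c n‖ ^ 2 =
      L * ∑ n ∈ Finset.range L, ‖c n‖ ^ 2 := by
  have key : ∑ j ∈ Finset.range L, ⟪∑ n ∈ Finset.range L, ω ^ (j * n) • c n,
      ∑ n ∈ Finset.range L, ω ^ (j * n) • c n⟫_ℂ =
      L * ∑ n ∈ Finset.range L, ⟪c n, c n⟫_ℂ := by
    simp only [sum_inner, inner_sum, inner_smul_left, inner_smul_right, Finset.mul_sum]
    rw [Finset.sum_comm]
    refine Finset.sum_congr rfl fun n hn => ?_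
    rw [Finset.sum_comm]
    have : ∀ m ∈ Finset.range L, ∑ j ∈ Finset.range L,
        ω ^ (j * n) * ((starRingEnd ℂ) (ω ^ (j * m)) * ⟪c m, c n⟫_ℂ) =
        if m = n then (L : ℂ) * ⟪c n, c n⟫_ℂ else 0 := by
      intro m hm
      rw [Finset.sum_congr rfl fun j _ => show _ = ((starRingEnd ℂ) (ω ^ (j * m)) *
        ω ^ (j * n)) * ⟪c m, c n⟫_ℂ by ring]
      rw [← Finset.sum_mul, sum_root_orthogonal hω hL (Finset.mem_range.1 hm)
        (Finset.mem_range.1 hn)]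
      split_ifs with h
      · rw [h]
      · simp
    rw [Finset.sum_congr rfl this]
    simp [Finset.mem_range.1 hn]
  simp only [inner_self_eq_norm_sq_to_K] at key
  apply Complex.ofReal_injective
  push_cast
  exact key

theorem IsContractiveAnalytic.norm_coeff_le [CompleteSpace E] {Θ : ℂ → E →L[ℂ] E}
    (h : IsContractiveAnalytic Θ) (k : ℕ) : ‖coeff Θ k‖ ≤ 1 := by
  have key : ∀ r ∈ Set.Ioo (0 : ℝ) 1, ‖coeff Θ k‖ * r ^ k ≤ 1 := by
    intro r hr
    have h1 := Complex.norm_iteratedDeriv_le_of_forall_mem_sphere_norm_le (f := Θ) (c := 0) (C := 1)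
      k hr.1 ?_ ?_
    · rw [coeff, norm_smul, norm_inv, Complex.norm_natCast]
      have hk : (0 : ℝ) < k.factorial := by exact_mod_cast k.factorial_pos
      rw [mul_one, le_div_iff₀ (pow_pos hr.1 k)] at h1
      rw [mul_assoc, inv_mul_le_iff₀ hk, mul_one]
      exact h1
    · refine (h.differentiableOn.mono ?_).diffContOnCl
      intro z hz
      have := Metric.closure_ball_subset_closedBall hz
      simp only [Metric.mem_closedBall, dist_zero_right, Metric.mem_ball] at this ⊢
      linarith [hr.2]
    · intro z hz
      apply h.norm_le_one
      simp only [Metric.mem_sphere, dist_zero_right, Metric.mem_ball] at hz ⊢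
      linarith [hr.2]
  have ht : Filter.Tendsto (fun r : ℝ => ‖coeff Θ k‖ * r ^ k) (nhdsWithin 1 (Set.Iio 1))
      (nhds (‖coeff Θ k‖ * 1 ^ k)) := by
    refine Filter.Tendsto.mono_left (Continuous.tendsto (by fun_prop) _) nhdsWithin_le_nhds
  rw [one_pow, mul_one] at ht
  refine le_of_tendsto ht ?_
  filter_upwards [Ioo_mem_nhdsLT (zero_lt_one' ℝ)] with r hr using key r hr

theorem IsContractiveAnalytic.hasSum_coeff [CompleteSpace E] {Θ : ℂ → E →L[ℂ] E}
    (h : IsContractiveAnalytic Θ) {z : ℂ} (hz : ‖z‖ < 1) :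
    HasSum (fun k => z ^ k • coeff Θ k) (Θ z) := by
  have := Complex.hasSum_taylorSeries_on_ball (c := 0) (r := 1) (f := Θ) (z := z)
    (by simpa using h.differentiableOn) (by simpa using hz)
  simp only [sub_zero] at this
  have e : (fun k => z ^ k • coeff Θ k) =
      fun k => ((k.factorial : ℂ)⁻¹) • z ^ k • iteratedDeriv k Θ 0 := by
    funext k
    rw [coeff, smul_comm]
  rw [e]
  exact this

/-- The partial sums of the power series of `Θ` are almost contractive on smaller circles. -/
theorem IsContractiveAnalytic.norm_partial_le [CompleteSpace E] {Θ : ℂ → E →L[ℂ] E}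
    (h : IsContractiveAnalytic Θ) {r : ℝ} (hr : r ∈ Set.Ioo (0 : ℝ) 1) {z : ℂ} (hz : ‖z‖ = r)
    (M : ℕ) : ‖∑ k ∈ Finset.range M, z ^ k • coeff Θ k‖ ≤ 1 + r ^ M / (1 - r) := by
  have hs := h.hasSum_coeff (z := z) (by rw [hz]; exact hr.2)
  have h1 := (hasSum_nat_add_iff' M).2 hs
  have h2 : HasSum (fun k => r ^ M * r ^ k) (r ^ M * (1 - r)⁻¹) :=
    (hasSum_geometric_of_lt_one hr.1.le hr.2).mul_left _
  have h3 : ‖Θ z - ∑ k ∈ Finset.range M, z ^ k • coeff Θ k‖ ≤ r ^ M * (1 - r)⁻¹ := by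
    rw [← h1.tsum_eq]
    refine tsum_of_norm_bounded h2 fun k => ?_
    rw [norm_smul, norm_pow, hz, ← pow_add, add_comm M k]
    exact mul_le_of_le_one_right (pow_nonneg hr.1.le _) (h.norm_coeff_le _)
  have h4 : ‖Θ z‖ ≤ 1 := h.norm_le_one z (by simpa [hz] using hr.2)
  have h5 := norm_sub_norm_le (∑ k ∈ Finset.range M, z ^ k • coeff Θ k) (Θ z)
  rw [norm_sub_rev] at h5
  rw [div_eq_mul_inv]
  linarith

theorem IsContractiveAnalytic.sum_cauchy_le [CompleteSpace E] {Θ : ℂ → E →L[ℂ] E}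
    (h : IsContractiveAnalytic Θ) (x : ℕ → E) (N : ℕ) :
    ∑ n ∈ Finset.range N, ‖∑ k ∈ Finset.range (n + 1), coeff Θ k (x (n - k))‖ ^ 2 ≤
      ∑ n ∈ Finset.range N, ‖x n‖ ^ 2 := by
  rcases Nat.eq_zero_or_pos N with rfl | hN
  · simp
  have step1 : ∀ r ∈ Set.Ioo (0 : ℝ) 1, ∀ M, N ≤ M →
      ∑ n ∈ Finset.range N,
        ‖∑ k ∈ Finset.range (n + 1), ((r : ℂ) ^ k) • coeff Θ k (x (n - k))‖ ^ 2 ≤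
      (1 + r ^ M / (1 - r)) ^ 2 * ∑ n ∈ Finset.range N, ‖x n‖ ^ 2 := by
    intro r hr M hM
    set L := M + N with hLdef
    have hL : L ≠ 0 := by omega
    have hω := Complex.isPrimitiveRoot_exp L hL
    set ω := Complex.exp (2 * Real.pi * Complex.I / L) with hωdef
    have hnorm : ‖ω‖ = 1 := hω.norm'_eq_one hL
    set c : ℕ → E := fun n => ∑ k ∈ Finset.range M, ∑ l ∈ Finset.range N,
      if k + l = n then ((r : ℂ) ^ k) • coeff Θ k (x l) else 0 with hc
    set y : ℕ → E := fun n => if n < N then x n else 0 with hy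
    have hg : ∀ j, ∑ n ∈ Finset.range L, ω ^ (j * n) • c n =
        (∑ k ∈ Finset.range M, ((r : ℂ) * ω ^ j) ^ k • coeff Θ k)
          (∑ n ∈ Finset.range L, ω ^ (j * n) • y n) := by
      intro j
      have hy' : ∑ n ∈ Finset.range L, ω ^ (j * n) • y n =
          ∑ n ∈ Finset.range N, ω ^ (j * n) • x n := by
        symm
        rw [← Finset.sum_subset (Finset.range_mono (by omega : N ≤ L))]
        · refine Finset.sum_congr rfl fun n hn => ?_
          simp [hy, Finset.mem_range.1 hn]
        · intro n _ hn
          simp only [Finset.mem_range] at hn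
          simp [hy, hn]
      rw [hy', sum_apply]
      simp only [hc, Finset.smul_sum, map_sum]
      rw [Finset.sum_comm]
      refine Finset.sum_congr rfl fun k hk => ?_
      rw [Finset.sum_comm]
      refine Finset.sum_congr rfl fun l hl => ?_
      rw [Finset.mem_range] at hk hl
      rw [Finset.sum_eq_single (k + l)]
      · simp only [if_true, smul_apply, map_smul, smul_smul]
        congr 1
        ring
      · intro n _ hn
        rw [if_neg (Ne.symm hn), smul_zero]
      · intro hn
        exact absurd (Finset.mem_range.2 (by omega)) hn
    have hcn : ∀ n ∈ Finset.range N, c n =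
        ∑ k ∈ Finset.range (n + 1), ((r : ℂ) ^ k) • coeff Θ k (x (n - k)) := by
      intro n hn
      rw [Finset.mem_range] at hn
      simp only [hc]
      symm
      rw [← Finset.sum_subset (Finset.range_mono (by omega : n + 1 ≤ M))]
      · refine Finset.sum_congr rfl fun k hk => ?_
        rw [Finset.mem_range] at hk
        rw [Finset.sum_eq_single (n - k)]
        · rw [if_pos (by omega)]
        · intro l _ hl
          rw [if_neg (by omega)]
        · intro hl
          exact absurd (Finset.mem_range.2 (by omega)) hl
      · intro k _ hk
        rw [Finset.mem_range] at hk
        refine Finset.sum_eq_zero fun l _ => ?_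
        rw [if_neg (by omega)]
    have hb : (0 : ℝ) ≤ 1 + r ^ M / (1 - r) := by
      have := pow_nonneg hr.1.le M
      have := div_nonneg this (sub_nonneg.2 hr.2.le)
      linarith
    have hP : ∑ n ∈ Finset.range L, ‖c n‖ ^ 2 ≤
        (1 + r ^ M / (1 - r)) ^ 2 * ∑ n ∈ Finset.range L, ‖y n‖ ^ 2 := by
      have hLpos : (0 : ℝ) < L := by exact_mod_cast Nat.pos_of_ne_zero hL
      refine le_of_mul_le_mul_left ?_ hLpos
      rw [← discrete_parseval hω hL, mul_left_comm, ← discrete_parseval hω hL, Finset.mul_sum]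
      refine Finset.sum_le_sum fun j _ => ?_
      rw [hg, ← mul_pow]
      refine pow_le_pow_left₀ (norm_nonneg _) ?_ 2
      refine (ContinuousLinearMap.le_opNorm _ _).trans ?_
      refine mul_le_mul_of_nonneg_right ?_ (norm_nonneg _)
      refine h.norm_partial_le hr ?_ M
      rw [norm_mul, norm_pow, hnorm, one_pow, mul_one, Complex.norm_real, Real.norm_of_nonneg hr.1.le]
    have hy2 : ∑ n ∈ Finset.range L, ‖y n‖ ^ 2 = ∑ n ∈ Finset.range N, ‖x n‖ ^ 2 := by
      symm
      rw [← Finset.sum_subset (Finset.range_mono (by omega : N ≤ L))]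
      · refine Finset.sum_congr rfl fun n hn => ?_
        simp [hy, Finset.mem_range.1 hn]
      · intro n _ hn
        simp only [Finset.mem_range] at hn
        simp [hy, hn]
    rw [hy2] at hP
    refine le_trans ?_ hP
    rw [Finset.sum_congr rfl fun n hn => by rw [← hcn n hn]]
    exact Finset.sum_le_sum_of_subset_of_nonneg (Finset.range_mono (by omega))
      fun _ _ _ => by positivity
  have step2 : ∀ r ∈ Set.Ioo (0 : ℝ) 1,
      ∑ n ∈ Finset.range N,
        ‖∑ k ∈ Finset.range (n + 1), ((r : ℂ) ^ k) • coeff Θ k (x (n - k))‖ ^ 2 ≤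
      ∑ n ∈ Finset.range N, ‖x n‖ ^ 2 := by
    intro r hr
    have ht : Filter.Tendsto
        (fun M : ℕ => (1 + r ^ M / (1 - r)) ^ 2 * ∑ n ∈ Finset.range N, ‖x n‖ ^ 2)
        Filter.atTop (nhds ((1 + 0 / (1 - r)) ^ 2 * ∑ n ∈ Finset.range N, ‖x n‖ ^ 2)) :=
      (((tendsto_pow_atTop_nhds_zero_of_lt_one hr.1.le hr.2).div_const _).const_add 1
        |>.pow 2).mul_const _
    simp only [zero_div, add_zero, one_pow, one_mul] at ht
    refine ge_of_tendsto ht ?_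
    filter_upwards [Filter.eventually_ge_atTop N] with M hM using step1 r hr M hM
  have ht : Filter.Tendsto (fun r : ℝ => ∑ n ∈ Finset.range N,
        ‖∑ k ∈ Finset.range (n + 1), ((r : ℂ) ^ k) • coeff Θ k (x (n - k))‖ ^ 2)
      (nhdsWithin 1 (Set.Iio 1)) (nhds (∑ n ∈ Finset.range N,
        ‖∑ k ∈ Finset.range (n + 1), (((1 : ℝ) : ℂ) ^ k) • coeff Θ k (x (n - k))‖ ^ 2)) := by
    refine Filter.Tendsto.mono_left (Continuous.tendsto (by fun_prop) _) nhdsWithin_le_nhds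
  simp only [Complex.ofReal_one, one_pow, one_smul] at ht
  refine le_of_tendsto ht ?_
  filter_upwards [Ioo_mem_nhdsLT (zero_lt_one' ℝ)] with r hr using step2 r hr

/-- Any finitely many of the series `∑ Θ_k y_k` are controlled by the `ℓ²` norm of `y`. -/
theorem IsContractiveAnalytic.norm_sum_sq_le [CompleteSpace E] {Θ : ℂ → E →L[ℂ] E}
    (h : IsContractiveAnalytic Θ) (y : ℕ → E) (s : Finset ℕ) :
    ‖∑ k ∈ s, coeff Θ k (y k)‖ ^ 2 ≤ ∑ k ∈ s, ‖y k‖ ^ 2 := by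
  set n := s.sup id with hn
  have hs : s ⊆ Finset.range (n + 1) := fun k hk =>
    Finset.mem_range.2 (Nat.lt_succ_of_le (Finset.le_sup (f := id) hk))
  have h1 := h.sum_cauchy_le (fun l => if n - l ∈ s then y (n - l) else 0) (n + 1)
  have h2 := (Finset.single_le_sum (f := fun m => ‖∑ k ∈ Finset.range (m + 1),
    coeff Θ k (if n - (m - k) ∈ s then y (n - (m - k)) else 0)‖ ^ 2)
    (fun _ _ => by positivity) (Finset.self_mem_range_succ n)).trans h1
  have h3 : ∑ k ∈ Finset.range (n + 1),
      coeff Θ k (if n - (n - k) ∈ s then y (n - (n - k)) else 0) = ∑ k ∈ s, coeff Θ k (y k) := by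
    symm
    rw [← Finset.sum_subset hs]
    · refine Finset.sum_congr rfl fun k hk => ?_
      have : n - (n - k) = k := by have := Finset.mem_range.1 (hs hk); omega
      rw [this, if_pos hk]
    · intro k hk hks
      have : n - (n - k) = k := by have := Finset.mem_range.1 hk; omega
      rw [this, if_neg hks, map_zero]
  have h4 : ∑ l ∈ Finset.range (n + 1), ‖if n - l ∈ s then y (n - l) else 0‖ ^ 2 =
      ∑ k ∈ s, ‖y k‖ ^ 2 := by
    have := Finset.sum_range_reflect (fun k => ‖if k ∈ s then y k else 0‖ ^ 2) (n + 1)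
    simp only [Nat.add_sub_cancel] at this
    rw [this]
    symm
    rw [← Finset.sum_subset hs]
    · exact Finset.sum_congr rfl fun k hk => by rw [if_pos hk]
    · intro k _ hks
      simp [hks]
  rw [h3, h4] at h2
  exact h2

theorem IsContractiveAnalytic.summable_coeff [CompleteSpace E] {Θ : ℂ → E →L[ℂ] E}
    (h : IsContractiveAnalytic Θ) {y : ℕ → E} (hy : Summable fun k => ‖y k‖ ^ 2) :
    Summable fun k => coeff Θ k (y k) := by
  rw [summable_iff_vanishing_norm] at hy ⊢
  intro ε hε
  obtain ⟨s, hs⟩ := hy (ε ^ 2) (by positivity)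
  refine ⟨s, fun t ht => ?_⟩
  have h1 := hs t ht
  rw [Real.norm_of_nonneg (Finset.sum_nonneg fun _ _ => by positivity)] at h1
  exact lt_of_pow_lt_pow_left₀ 2 hε.le ((h.norm_sum_sq_le y t).trans_lt h1)

end Coefficients

section SequenceSpaces

variable {E F X ι κ : Type*} [NormedAddCommGroup E] [InnerProductSpace ℂ E]
  [NormedAddCommGroup F] [InnerProductSpace ℂ F] [NormedAddCommGroup X] [NormedSpace ℂ X]

/-- The Hardy space `H²(E)`: square summable power series `∑ z ^ n f n`, `n ≥ 0`, with
coefficients in `E`. -/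
abbrev HardySpace (E : Type*) [NormedAddCommGroup E] : Type _ := lp (fun _ : ℕ => E) 2

/-- The space `L²(E)`: square summable Laurent series `∑ ζ ^ n f n`, `n ∈ ℤ`, with coefficients
in `E` (equivalently, square integrable `E`-valued functions on the unit circle, through their
Fourier coefficients). -/
abbrev LaurentSpace (E : Type*) [NormedAddCommGroup E] : Type _ := lp (fun _ : ℤ => E) 2

theorem sum_norm_sq_le (f : lp (fun _ : ι => E) 2) (s : Finset ι) :
    ∑ i ∈ s, ‖f i‖ ^ 2 ≤ ‖f‖ ^ 2 := by
  have := lp.sum_rpow_le_norm_rpow (p := 2) (by norm_num) f s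
  simpa using this

theorem summable_norm_sq (f : lp (fun _ : ι => E) 2) : Summable fun i => ‖f i‖ ^ 2 :=
  summable_of_sum_le (fun _ => by positivity) (sum_norm_sq_le f)

theorem sum_norm_sq_comp_le (f : lp (fun _ : ι => E) 2) {g : κ → ι} (hg : g.Injective)
    (s : Finset κ) : ∑ i ∈ s, ‖f (g i)‖ ^ 2 ≤ ‖f‖ ^ 2 := by
  have := sum_norm_sq_le f (s.map ⟨g, hg⟩)
  simpa using this

/-- The contraction into `ℓ²(ι, F)` with given coordinates. -/
noncomputable def ofCoords (A : X →ₗ[ℂ] (ι → F))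
    (hA : ∀ x (s : Finset ι), ∑ i ∈ s, ‖A x i‖ ^ 2 ≤ ‖x‖ ^ 2) :
    X →L[ℂ] lp (fun _ : ι => F) 2 :=
  LinearMap.mkContinuous
    { toFun := fun x => ⟨A x, memℓp_gen' (C := ‖x‖ ^ 2) fun s => by simpa using hA x s⟩
      map_add' := fun x y => by ext i; exact congrFun (map_add A x y) i
      map_smul' := fun c x => by ext i; exact congrFun (map_smul A c x) i } 1
    (fun x => by
      rw [one_mul]
      exact lp.norm_le_of_forall_sum_le (by norm_num) (norm_nonneg _)
        fun s => by simpa using hA x s)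

@[simp] theorem ofCoords_apply (A : X →ₗ[ℂ] (ι → F))
    (hA : ∀ x (s : Finset ι), ∑ i ∈ s, ‖A x i‖ ^ 2 ≤ ‖x‖ ^ 2) (x : X) (i : ι) :
    ofCoords A hA x i = A x i := rfl

theorem norm_ofCoords_apply_le (A : X →ₗ[ℂ] (ι → F))
    (hA : ∀ x (s : Finset ι), ∑ i ∈ s, ‖A x i‖ ^ 2 ≤ ‖x‖ ^ 2) (x : X) :
    ‖ofCoords A hA x‖ ≤ ‖x‖ :=
  lp.norm_le_of_forall_sum_le (by norm_num) (norm_nonneg _) fun s => by simpa using hA x s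

/-- The unilateral shift `S_E` on `H²(E)`: multiplication by `z`, so `(S f)_0 = 0` and
`(S f)_(n+1) = f_n`. -/
noncomputable def unilateralShift (E : Type*) [NormedAddCommGroup E] [InnerProductSpace ℂ E] :
    HardySpace E →L[ℂ] HardySpace E :=
  ofCoords
    { toFun := fun f n => Nat.casesOn n 0 fun m => f m
      map_add' := fun f g => by ext n; cases n <;> simp
      map_smul' := fun c f => by ext n; cases n <;> simp }
    (fun f s => by
      refine le_trans ?_ (sum_norm_sq_le f (s.image Nat.pred))
      rw [← Finset.sum_filter_add_sum_filter_not s (· = 0)]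
      rw [Finset.sum_eq_zero fun n hn => by rw [(Finset.mem_filter.1 hn).2]; simp, zero_add]
      rw [Finset.sum_congr rfl fun n hn => show _ = ‖f n.pred‖ ^ 2 by
        cases n with
        | zero => exact absurd rfl (Finset.mem_filter.1 hn).2
        | succ m => rfl]
      rw [← Finset.sum_image (f := fun m => ‖f m‖ ^ 2) (g := Nat.pred)]
      · exact Finset.sum_le_sum_of_subset_of_nonneg
          (Finset.image_subset_image (Finset.filter_subset _ _)) fun _ _ _ => by positivity
      · intro a ha b hb hab
        have ha' := (Finset.mem_filter.1 (Finset.mem_coe.1 ha)).2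
        have hb' := (Finset.mem_filter.1 (Finset.mem_coe.1 hb)).2
        simp only [Nat.pred_eq_sub_one] at hab
        omega)

/-- Multiplication by `ζ ^ m` on `L²(E)`. -/
noncomputable def translate (E : Type*) [NormedAddCommGroup E] [InnerProductSpace ℂ E] (m : ℤ) :
    LaurentSpace E →L[ℂ] LaurentSpace E :=
  ofCoords
    { toFun := fun f n => f (n - m)
      map_add' := fun f g => by ext n; simp
      map_smul' := fun c f => by ext n; simp }
    (fun f s => sum_norm_sq_comp_le f (sub_left_injective (b := m)) s)

/-- The bilateral shift `U_E` on `L²(E)`: multiplication by `ζ`. -/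
noncomputable def bilateralShift (E : Type*) [NormedAddCommGroup E] [InnerProductSpace ℂ E] :
    LaurentSpace E →L[ℂ] LaurentSpace E :=
  translate E 1

/-- The inclusion `H²(E) ⊆ L²(E)`. -/
noncomputable def hardyInclusion (E : Type*) [NormedAddCommGroup E] [InnerProductSpace ℂ E] :
    HardySpace E →L[ℂ] LaurentSpace E :=
  ofCoords
    { toFun := fun f n => if 0 ≤ n then f n.toNat else 0
      map_add' := fun f g => by ext n; by_cases hn : 0 ≤ n <;> simp [hn]
      map_smul' := fun c f => by ext n; by_cases hn : 0 ≤ n <;> simp [hn] }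
    (fun f s => by
      refine le_trans ?_ (sum_norm_sq_le f (s.image Int.toNat))
      rw [← Finset.sum_filter_add_sum_filter_not s (0 ≤ ·)]
      rw [Finset.sum_eq_zero (s := s.filter fun n => ¬ 0 ≤ n) fun n hn => by
        simp only [LinearMap.coe_mk, AddHom.coe_mk]
        rw [if_neg (Finset.mem_filter.1 hn).2]; simp, add_zero]
      rw [Finset.sum_congr rfl fun n hn => show _ = ‖f n.toNat‖ ^ 2 by
        simp only [LinearMap.coe_mk, AddHom.coe_mk]
        rw [if_pos (Finset.mem_filter.1 hn).2]]
      rw [← Finset.sum_image (f := fun m => ‖f m‖ ^ 2) (g := Int.toNat)]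
      · exact Finset.sum_le_sum_of_subset_of_nonneg
          (Finset.image_subset_image (Finset.filter_subset _ _)) fun _ _ _ => by positivity
      · intro a ha b hb hab
        have ha' := (Finset.mem_filter.1 (Finset.mem_coe.1 ha)).2
        have hb' := (Finset.mem_filter.1 (Finset.mem_coe.1 hb)).2
        omega)

/-- The contraction `T` on `F` applied to every coefficient of a power series in `H²(F)`. -/
noncomputable def coefficientwise (T : F →L[ℂ] F) (hT : ∀ x, ‖T x‖ ≤ ‖x‖) :
    HardySpace F →L[ℂ] HardySpace F :=
  ofCoords
    { toFun := fun f n => T (f n)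
      map_add' := fun f g => by ext n; simp
      map_smul' := fun c f => by ext n; simp }
    (fun f s => le_trans (Finset.sum_le_sum fun n _ =>
      pow_le_pow_left₀ (norm_nonneg _) (hT (f n)) 2) (sum_norm_sq_le f s))

end SequenceSpaces

section SquareRoot

variable {H : Type*} [NormedAddCommGroup H] [InnerProductSpace ℂ H] [CompleteSpace H]

/-- The nonnegative square root `(I - A* A)^(1/2)` for a contraction `A`. -/
noncomputable def defectOperator (A : H →L[ℂ] H) : H →L[ℂ] H :=
  CFC.sqrt (1 - ContinuousLinearMap.adjoint A * A)

/-- For a contraction `A` the operator under the square root is nonnegative, so that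
`defectOperator A` is its nonnegative square root. -/
theorem defectOperator_mul_self {A : H →L[ℂ] H} (hA : ∀ x, ‖A x‖ ≤ ‖x‖) :
    defectOperator A * defectOperator A = 1 - ContinuousLinearMap.adjoint A * A := by
  refine CFC.sqrt_mul_sqrt_self _ ?_
  rw [ContinuousLinearMap.nonneg_iff_isPositive, ContinuousLinearMap.isPositive_iff_complex]
  intro x
  have h : ⟪(1 - ContinuousLinearMap.adjoint A * A) x, x⟫_ℂ =
      ((‖x‖ ^ 2 - ‖A x‖ ^ 2 : ℝ) : ℂ) := by
    rw [sub_apply, inner_sub_left, ContinuousLinearMap.mul_def,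
      ContinuousLinearMap.comp_apply, ContinuousLinearMap.adjoint_inner_left,
      one_apply_eq_self, inner_self_eq_norm_sq_to_K, inner_self_eq_norm_sq_to_K]
    push_cast
    rfl
  rw [h]
  refine ⟨rfl, ?_⟩
  exact sub_nonneg.2 (pow_le_pow_left₀ (norm_nonneg _) (hA x) 2)

theorem defectOperator_commute {A B : H →L[ℂ] H}
    (h : Commute (1 - ContinuousLinearMap.adjoint A * A) B) : Commute (defectOperator A) B :=
  h.cfcₙ_nnreal _

end SquareRoot

section Model

variable {E : Type*} [NormedAddCommGroup E] [InnerProductSpace ℂ E] [CompleteSpace E]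
  {Θ : ℂ → E →L[ℂ] E}

/-- The analytic Toeplitz operator `T_Θ` on `H²(E)`: multiplication of power series by
`Θ(z) = ∑ z ^ k Θ_k`. -/
noncomputable def toeplitz (hΘ : IsContractiveAnalytic Θ) : HardySpace E →L[ℂ] HardySpace E :=
  ofCoords
    { toFun := fun f n => ∑ k ∈ Finset.range (n + 1), coeff Θ k (f (n - k))
      map_add' := fun f g => by ext n; simp [Finset.sum_add_distrib]
      map_smul' := fun c f => by ext n; simp [Finset.smul_sum] }
    (fun f s => by
      obtain ⟨N, hN⟩ := s.exists_nat_subset_range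
      exact (Finset.sum_le_sum_of_subset_of_nonneg hN fun _ _ _ => by positivity).trans
        ((hΘ.sum_cauchy_le (fun n => f n) N).trans (sum_norm_sq_le f _)))

theorem IsContractiveAnalytic.summable_laurent (hΘ : IsContractiveAnalytic Θ)
    (f : LaurentSpace E) (n : ℤ) : Summable fun k : ℕ => coeff Θ k (f (n - k)) :=
  hΘ.summable_coeff <| (summable_norm_sq f).comp_injective (i := fun k : ℕ => n - (k : ℤ))
    fun a b hab => by simpa using hab

/-- The Laurent operator `L_Θ` on `L²(E)`: multiplication of Laurent series by
`Θ(ζ) = ∑ ζ ^ k Θ_k`. -/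
noncomputable def laurent (hΘ : IsContractiveAnalytic Θ) : LaurentSpace E →L[ℂ] LaurentSpace E :=
  ofCoords
    { toFun := fun f n => ∑' k : ℕ, coeff Θ k (f (n - k))
      map_add' := fun f g => by
        ext n
        simp only [lp.coeFn_add, Pi.add_apply, map_add]
        exact (hΘ.summable_laurent f n).tsum_add (hΘ.summable_laurent g n)
      map_smul' := fun c f => by
        ext n
        simp only [lp.coeFn_smul, Pi.smul_apply, map_smul, RingHom.id_apply]
        exact (hΘ.summable_laurent f n).tsum_const_smul c }
    (fun f s => by
      have ht : Filter.Tendsto (fun K : ℕ => ∑ n ∈ s,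
          ‖∑ k ∈ Finset.range ((n + K).toNat + 1), coeff Θ k (f (n - k))‖ ^ 2) Filter.atTop
          (nhds (∑ n ∈ s, ‖∑' k : ℕ, coeff Θ k (f (n - k))‖ ^ 2)) := by
        refine tendsto_finsetSum _ fun n _ => ?_
        refine ((Filter.Tendsto.comp (hΘ.summable_laurent f n).hasSum.tendsto_sum_nat ?_).norm).pow 2
        refine Filter.tendsto_atTop.2 fun b => ?_
        filter_upwards [Filter.eventually_ge_atTop (b + n.natAbs)] with K hK
        omega
      refine le_of_tendsto ht ?_
      filter_upwards [Filter.eventually_ge_atTop (s.sup Int.natAbs)] with K hK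
      have hpos : ∀ n ∈ s, 0 ≤ n + K := fun n hn => by
        have : n.natAbs ≤ K := (Finset.le_sup (f := Int.natAbs) hn).trans hK
        omega
      obtain ⟨N, hN⟩ := (s.image fun n : ℤ => (n + K).toNat).exists_nat_subset_range
      have h1 := hΘ.sum_cauchy_le (fun l => f ((l : ℤ) - K)) N
      refine le_trans ?_ (h1.trans (sum_norm_sq_comp_le f (g := fun l : ℕ => (l : ℤ) - K)
        (fun a b hab => by simpa using hab) _))
      refine le_trans ?_ (Finset.sum_le_sum_of_subset_of_nonneg hN fun _ _ _ => by positivity)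
      rw [Finset.sum_image]
      · refine le_of_eq (Finset.sum_congr rfl fun n hn => ?_)
        have hn' := hpos n hn
        congr 2
        refine Finset.sum_congr rfl fun k hk => ?_
        rw [Finset.mem_range] at hk
        have hidx : n - (k : ℤ) = (((n + K).toNat - k : ℕ) : ℤ) - K := by omega
        rw [hidx]
      · intro a ha b hb hab
        have ha' := hpos a ha
        have hb' := hpos b hb
        simp only at hab
        omega)

theorem translate_comp_translate (m m' : ℤ) :
    translate E m ∘L translate E m' = translate E (m + m') := by
  ext f n
  simp only [translate, ContinuousLinearMap.comp_apply, ofCoords_apply, LinearMap.coe_mk,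
    AddHom.coe_mk]
  rw [sub_sub]

theorem translate_zero : translate E 0 = 1 := by
  ext f n
  simp [translate]

theorem norm_translate_apply_le (m : ℤ) (f : LaurentSpace E) : ‖translate E m f‖ ≤ ‖f‖ :=
  norm_ofCoords_apply_le _ _ _

theorem adjoint_translate (m : ℤ) :
    ContinuousLinearMap.adjoint (translate E m) = translate E (-m) := by
  have h1 : ContinuousLinearMap.adjoint (translate E m) ∘L translate E m = 1 := by
    rw [← ContinuousLinearMap.norm_map_iff_adjoint_comp_self]
    intro f
    refine le_antisymm (norm_translate_apply_le m f) ?_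
    have := norm_translate_apply_le (-m) (translate E m f)
    rwa [← ContinuousLinearMap.comp_apply, translate_comp_translate, neg_add_cancel,
      translate_zero, one_apply_eq_self] at this
  calc ContinuousLinearMap.adjoint (translate E m)
      = ContinuousLinearMap.adjoint (translate E m) ∘L (translate E m ∘L translate E (-m)) := by
        rw [translate_comp_translate, add_neg_cancel, translate_zero]; rfl
    _ = translate E (-m) := by
        rw [← ContinuousLinearMap.comp_assoc, h1]; rfl

theorem laurent_commute_translate (hΘ : IsContractiveAnalytic Θ) (m : ℤ) :
    Commute (laurent hΘ) (translate E m) := by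
  ext f n
  simp only [laurent, translate, ContinuousLinearMap.mul_def, ContinuousLinearMap.comp_apply,
    ofCoords_apply, LinearMap.coe_mk, AddHom.coe_mk]
  refine tsum_congr fun k => ?_
  rw [show n - (k : ℤ) - m = n - m - k by ring]

/-- `L_Θ` is the extension of `T_Θ` to `L²(E)`. -/
theorem laurent_hardyInclusion (hΘ : IsContractiveAnalytic Θ) (f : HardySpace E) :
    laurent hΘ (hardyInclusion E f) = hardyInclusion E (toeplitz hΘ f) := by
  ext n
  simp only [laurent, hardyInclusion, toeplitz, ofCoords_apply, LinearMap.coe_mk, AddHom.coe_mk]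
  split_ifs with hn
  · rw [tsum_eq_sum (s := Finset.range (n.toNat + 1))]
    · refine Finset.sum_congr rfl fun k hk => ?_
      rw [Finset.mem_range] at hk
      have h1 : (0 : ℤ) ≤ n - k := by omega
      have h2 : (n - (k : ℤ)).toNat = n.toNat - k := by omega
      rw [if_pos h1, h2]
    · intro k hk
      rw [Finset.mem_range] at hk
      have h1 : ¬ (0 : ℤ) ≤ n - k := by omega
      rw [if_neg h1, map_zero]
  · have h0 : ∀ k : ℕ, coeff Θ k
        (if (0 : ℤ) ≤ n - k then f (n - (k : ℤ)).toNat else 0) = 0 := fun k => by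
      have h1 : ¬ (0 : ℤ) ≤ n - k := by omega
      rw [if_neg h1, map_zero]
    rw [tsum_congr h0]
    exact tsum_zero

/-- The defect operator `D = (I - L_Θ* L_Θ)^(1/2)` on `L²(E)`, that is, multiplication by
`Δ(ζ) = (I - Θ(ζ)* Θ(ζ))^(1/2)`. -/
noncomputable def defect (hΘ : IsContractiveAnalytic Θ) : LaurentSpace E →L[ℂ] LaurentSpace E :=
  defectOperator (laurent hΘ)

theorem defect_mul_self (hΘ : IsContractiveAnalytic Θ) :
    defect hΘ * defect hΘ = 1 - ContinuousLinearMap.adjoint (laurent hΘ) * laurent hΘ :=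
  defectOperator_mul_self fun f => norm_ofCoords_apply_le _ _ f

theorem defect_commute_translate (hΘ : IsContractiveAnalytic Θ) (m : ℤ) :
    Commute (defect hΘ) (translate E m) := by
  have h1 : Commute (ContinuousLinearMap.adjoint (laurent hΘ)) (translate E m) := by
    have h2 := congrArg ContinuousLinearMap.adjoint (laurent_commute_translate hΘ (-m)).eq
    rw [ContinuousLinearMap.mul_def, ContinuousLinearMap.mul_def,
      ContinuousLinearMap.adjoint_comp, ContinuousLinearMap.adjoint_comp, adjoint_translate,
      neg_neg] at h2
    exact h2.symm
  exact defectOperator_commute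
    ((Commute.one_left _).sub_left (h1.mul_left (laurent_commute_translate hΘ m)))

/-- The defect space: the closure of `D L²(E)`. -/
noncomputable def defectSpace (hΘ : IsContractiveAnalytic Θ) : Submodule ℂ (LaurentSpace E) :=
  (LinearMap.range (defect hΘ : LaurentSpace E →ₗ[ℂ] LaurentSpace E)).topologicalClosure

instance (hΘ : IsContractiveAnalytic Θ) : CompleteSpace (defectSpace hΘ) :=
  (Submodule.isClosed_topologicalClosure _).completeSpace_coe

theorem defect_mem (hΘ : IsContractiveAnalytic Θ) (f : LaurentSpace E) :
    defect hΘ f ∈ defectSpace hΘ :=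
  Submodule.le_topologicalClosure _ ⟨f, rfl⟩

/-- The defect space is invariant for `U_E`. -/
theorem bilateralShift_mem (hΘ : IsContractiveAnalytic Θ) {f : LaurentSpace E}
    (hf : f ∈ defectSpace hΘ) : bilateralShift E f ∈ defectSpace hΘ := by
  refine map_mem_closure (bilateralShift E).continuous hf ?_
  rintro _ ⟨g, rfl⟩
  exact ⟨bilateralShift E g, congrArg (fun T => T g) (defect_commute_translate hΘ 1).eq⟩

/-- The restriction of `U_E` to the defect space. -/
noncomputable def defectShift (hΘ : IsContractiveAnalytic Θ) :
    defectSpace hΘ →L[ℂ] defectSpace hΘ :=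
  (bilateralShift E).restrict fun _ hf => bilateralShift_mem hΘ hf

/-- The model space `K = H²(E) ⊕ H²((D L²(E))⁻)`, an orthogonal sum of Hilbert spaces. An element
is written `f ⊕ g`; here `g = ∑ w ^ n g n` is a power series in `w` whose coefficients
`g n ∈ L²(E)` are functions of `ζ`. -/
abbrev ModelSpace (hΘ : IsContractiveAnalytic Θ) : Type _ :=
  WithLp 2 (HardySpace E × HardySpace (defectSpace hΘ))

/-- `W₀(f ⊕ g) = a ⊕ b` with `a(z) = z f(z)` and `b(w, ζ) = ζ g(w, ζ)`. -/
noncomputable def modelW₀ (hΘ : IsContractiveAnalytic Θ) : ModelSpace hΘ →L[ℂ] ModelSpace hΘ :=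
  let e := WithLp.prodContinuousLinearEquiv 2 ℂ (HardySpace E) (HardySpace (defectSpace hΘ))
  e.symm ∘L
    ((unilateralShift E).prodMap (coefficientwise (defectShift hΘ)
      fun g => norm_translate_apply_le 1 (g : LaurentSpace E))) ∘L e

/-- `W₁(f ⊕ g) = c ⊕ d` with `c(z) = Θ(z) f(z)` and `d(w, ζ) = Δ(ζ) f(ζ) + w g(w, ζ)`. -/
noncomputable def modelW₁ (hΘ : IsContractiveAnalytic Θ) : ModelSpace hΘ →L[ℂ] ModelSpace hΘ :=
  let e := WithLp.prodContinuousLinearEquiv 2 ℂ (HardySpace E) (HardySpace (defectSpace hΘ))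
  let Δ : HardySpace E →L[ℂ] defectSpace hΘ :=
    (defect hΘ ∘L hardyInclusion E).codRestrict _ fun f => defect_mem hΘ (hardyInclusion E f)
  e.symm ∘L
    ((toeplitz hΘ ∘L ContinuousLinearMap.fst ℂ _ _).prod
      (lp.singleContinuousLinearMap ℂ (fun _ : ℕ => defectSpace hΘ) 2 0 ∘L Δ ∘L
          ContinuousLinearMap.fst ℂ _ _ +
        unilateralShift (defectSpace hΘ) ∘L ContinuousLinearMap.snd ℂ _ _)) ∘L e

/-- The functional model `W(Θ) = (W₀, W₁)`. -/
noncomputable def model (hΘ : IsContractiveAnalytic Θ) :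
    Fin 2 → ModelSpace hΘ →L[ℂ] ModelSpace hΘ :=
  ![modelW₀ hΘ, modelW₁ hΘ]

end Model

end BiIsometry

/-! `W₀` and `W₁` are commuting isometries. The definition of `D` gives `‖T_Θ f‖² + ‖D f‖² = ‖f‖²`,
which makes `W₁` isometric. `W₀` is a shift plus a unitary, and its wandering space, the orthogonal
complement of its range, consists of the constants `x ∈ E`. Everything is decided by how `W₁` acts
on these constants.

Let `M` be reducing with `W₁ M = M`. On `M` the unitary `W₁` commutes with `W₀` and hence with
`W₀*`, so it maps the constants in `M` onto themselves. There it acts as `Θ(0)`, which is therefore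
unitary on the space `N` of these constants (`modelW₁_modelConst`,
`exists_modelConst_mem_apply_eq`). Moreover `M` has no component in `H²(𝔇)` (`snd_eq_zero`), so `M ≠
0` forces `N ≠ 0`.

Conversely, let `N` reduce `Θ(0)` to a unitary. Contractivity leaves no room for higher
coefficients: `Θ_k` and `Θ_k*` vanish on `N` for `k ≥ 1` (`coeff_apply_eq_zero`,
`adjoint_coeff_apply_eq_zero`). Hence `H²(N) ⊕ 0` reduces the model, and `W₁` acts on it as `Θ(0)`
on each coefficient.

This correspondence proves (2). For (1), take `M` to be the whole space; in the other direction `D =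
0`, so the second summand disappears. -/

namespace BiIsometry

set_option linter.unusedSectionVars false

/-! ### Unitary operators, restrictions and contractions on a Hilbert space. -/

section Unitary

variable {H : Type*} [NormedAddCommGroup H] [InnerProductSpace ℂ H] [CompleteSpace H]

theorem mem_unitary_iff_norm_map_surjective {T : H →L[ℂ] H} :
    T ∈ unitary (H →L[ℂ] H) ↔ (∀ x, ‖T x‖ = ‖x‖) ∧ Function.Surjective T := by
  constructor
  · intro h
    refine ⟨ContinuousLinearMap.norm_map_of_mem_unitary h, fun y => ⟨star T y, ?_⟩⟩
    exact congrArg (fun S => S y) (Unitary.mul_star_self_of_mem h)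
  · rintro ⟨h1, h2⟩
    have h3 : star T * T = 1 := (ContinuousLinearMap.norm_map_iff_adjoint_comp_self T).1 h1
    refine Unitary.mem_iff.2 ⟨h3, ?_⟩
    ext y
    obtain ⟨x, rfl⟩ := h2 y
    have h4 : star T (T x) = x := congrArg (fun S => S x) h3
    change T (star T (T x)) = T x
    rw [h4]

theorem inner_map_map_of_norm_map {T : H →L[ℂ] H} (h : ∀ x, ‖T x‖ = ‖x‖) (x y : H) :
    ⟪T x, T y⟫_ℂ = ⟪x, y⟫_ℂ :=
  (LinearMap.norm_map_iff_inner_map_map T).1 h x y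

/-- Isometry and surjectivity can be tested on vectors of the ambient space, so the adjoint of the
restriction never has to be computed. -/
theorem isUnitaryOn_restrict_iff {I : Type*} {V : I → H →L[ℂ] H} {M : Submodule ℂ H}
    [CompleteSpace M] (hM : IsReducing V M) (J : Set I) :
    IsUnitaryOn J hM.restrict ↔
      ∀ j ∈ J, (∀ x ∈ M, ‖V j x‖ = ‖x‖) ∧ ∀ y ∈ M, ∃ x ∈ M, V j x = y := by
  refine forall₂_congr fun j _ => ?_
  rw [mem_unitary_iff_norm_map_surjective]
  refine and_congr ⟨fun h x hx => h ⟨x, hx⟩, fun h x => h x x.2⟩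
    ⟨fun h y hy => ?_, fun h y => ?_⟩
  · obtain ⟨x, hx⟩ := h ⟨y, hy⟩
    exact ⟨x, x.2, congrArg Subtype.val hx⟩
  · obtain ⟨x, hx, hxy⟩ := h y y.2
    exact ⟨⟨x, hx⟩, Subtype.ext hxy⟩

theorem adjoint_defectOperator (A : H →L[ℂ] H) :
    ContinuousLinearMap.adjoint (defectOperator A) = defectOperator A := by
  have h : 0 ≤ defectOperator A := by
    rw [defectOperator]
    exact CFC.sqrt_nonneg _
  exact ((ContinuousLinearMap.nonneg_iff_isPositive _).1 h).isSelfAdjoint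

/-- Expanding the square gives `‖A*Ax - x‖² = ‖A*Ax‖² - 2‖Ax‖² + ‖x‖²`, which is at most `0` because
`‖A*Ax‖ ≤ ‖Ax‖ = ‖x‖`. -/
theorem adjoint_apply_apply_of_norm_eq {A : H →L[ℂ] H} (hA : ‖A‖ ≤ 1) {x : H}
    (hx : ‖A x‖ = ‖x‖) : ContinuousLinearMap.adjoint A (A x) = x := by
  have h1 : ‖ContinuousLinearMap.adjoint A (A x)‖ ≤ ‖x‖ := by
    have h := (ContinuousLinearMap.adjoint A).le_of_opNorm_le
      ((LinearIsometryEquiv.norm_map ContinuousLinearMap.adjoint A).trans_le hA) (A x)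
    rwa [one_mul, hx] at h
  have h2 := norm_sub_sq (𝕜 := ℂ) (ContinuousLinearMap.adjoint A (A x)) x
  rw [ContinuousLinearMap.adjoint_inner_left, inner_self_eq_norm_sq, hx] at h2
  have h3 := pow_le_pow_left₀ (norm_nonneg _) h1 2
  have h4 : ‖ContinuousLinearMap.adjoint A (A x) - x‖ = 0 := by
    refine pow_eq_zero_iff two_ne_zero |>.1 (le_antisymm (by linarith) (by positivity))
  exact sub_eq_zero.1 (norm_eq_zero.1 h4)

end Unitary

/-! ### Shifts, inclusions and coefficientwise operators on `H²` and `L²`. -/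

section Sequences

variable {E : Type*} [NormedAddCommGroup E] [InnerProductSpace ℂ E]

theorem hasSum_norm_sq {ι : Type*} (f : lp (fun _ : ι => E) 2) :
    HasSum (fun i => ‖f i‖ ^ 2) (‖f‖ ^ 2) := by
  simpa using lp.hasSum_norm (p := 2) (by norm_num) f

@[simp] theorem unilateralShift_apply_zero (f : HardySpace E) : unilateralShift E f 0 = 0 := rfl

@[simp] theorem unilateralShift_apply_succ (f : HardySpace E) (n : ℕ) :
    unilateralShift E f (n + 1) = f n := rfl

theorem norm_unilateralShift (f : HardySpace E) : ‖unilateralShift E f‖ = ‖f‖ := by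
  refine (sq_eq_sq₀ (norm_nonneg _) (norm_nonneg _)).1 ?_
  refine (hasSum_norm_sq _).unique ?_
  rw [← hasSum_nat_add_iff' 1]
  simpa using hasSum_norm_sq f

/-- The backward shift on `H²(E)`. -/
noncomputable def backwardShift (E : Type*) [NormedAddCommGroup E] [InnerProductSpace ℂ E] :
    HardySpace E →L[ℂ] HardySpace E :=
  ofCoords
    { toFun := fun f n => f (n + 1)
      map_add' := fun f g => by ext n; simp
      map_smul' := fun c f => by ext n; simp }
    (fun f s => sum_norm_sq_comp_le f (add_left_injective 1) s)

@[simp] theorem backwardShift_apply (f : HardySpace E) (n : ℕ) :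
    backwardShift E f n = f (n + 1) := rfl

theorem unilateralShift_backwardShift (f : HardySpace E) :
    unilateralShift E (backwardShift E f) + lp.single 2 0 (f 0) = f := by
  ext n
  cases n with
  | zero => simp
  | succ n => simp

@[simp] theorem translate_apply (m : ℤ) (f : LaurentSpace E) (n : ℤ) :
    translate E m f n = f (n - m) := rfl

theorem norm_translate [CompleteSpace E] (m : ℤ) (f : LaurentSpace E) : ‖translate E m f‖ = ‖f‖ := by
  refine le_antisymm (norm_translate_apply_le m f) ?_
  have := norm_translate_apply_le (-m) (translate E m f)
  rwa [← ContinuousLinearMap.comp_apply, translate_comp_translate, neg_add_cancel,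
    translate_zero, one_apply_eq_self] at this

theorem norm_hardyInclusion (f : HardySpace E) : ‖hardyInclusion E f‖ = ‖f‖ := by
  refine (sq_eq_sq₀ (norm_nonneg _) (norm_nonneg _)).1 ?_
  refine (hasSum_norm_sq _).unique ?_
  have h := (Function.Injective.hasSum_iff (f := fun n : ℤ => ‖hardyInclusion E f n‖ ^ 2)
    (a := ‖f‖ ^ 2) (Nat.cast_injective (R := ℤ)) ?_).1
  · exact h (hasSum_norm_sq f)
  · intro n hn
    have : ¬ 0 ≤ n := fun h0 => hn ⟨n.toNat, Int.toNat_of_nonneg h0⟩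
    simp [hardyInclusion, this]

theorem hardyInclusion_unilateralShift (f : HardySpace E) :
    hardyInclusion E (unilateralShift E f) = translate E 1 (hardyInclusion E f) := by
  ext n
  change (if 0 ≤ n then unilateralShift E f n.toNat else 0) =
    if 0 ≤ n - 1 then f (n - 1).toNat else 0
  rcases lt_trichotomy n 0 with h | rfl | h
  · rw [if_neg (by omega), if_neg (by omega)]
  · simp
  · obtain ⟨k, rfl⟩ : ∃ k : ℕ, n = k + 1 := ⟨(n - 1).toNat, by omega⟩
    rw [if_pos (by omega), if_pos (by omega)]
    have h1 : ((k : ℤ) + 1).toNat = k + 1 := by omega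
    have h2 : ((k : ℤ) + 1 - 1).toNat = k := by omega
    rw [h1, h2, unilateralShift_apply_succ]

@[simp] theorem coefficientwise_apply (T : E →L[ℂ] E) (hT : ∀ x, ‖T x‖ ≤ ‖x‖) (f : HardySpace E)
    (n : ℕ) : coefficientwise T hT f n = T (f n) := rfl

theorem norm_coefficientwise (T : E →L[ℂ] E) (hT : ∀ x, ‖T x‖ = ‖x‖) (f : HardySpace E) :
    ‖coefficientwise T (fun x => (hT x).le) f‖ = ‖f‖ := by
  refine (sq_eq_sq₀ (norm_nonneg _) (norm_nonneg _)).1 ?_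
  refine (hasSum_norm_sq _).unique ?_
  simpa [hT] using hasSum_norm_sq f

end Sequences

/-! ### The model as a pair of commuting isometries, and the wandering space of `W₀`. -/

section Model

variable {E : Type*} [NormedAddCommGroup E] [InnerProductSpace ℂ E] [CompleteSpace E]
  {Θ : ℂ → E →L[ℂ] E}

theorem toeplitz_apply (hΘ : IsContractiveAnalytic Θ) (f : HardySpace E) (n : ℕ) :
    toeplitz hΘ f n = ∑ k ∈ Finset.range (n + 1), coeff Θ k (f (n - k)) := rfl

theorem laurent_apply (hΘ : IsContractiveAnalytic Θ) (f : LaurentSpace E) (n : ℤ) :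
    laurent hΘ f n = ∑' k : ℕ, coeff Θ k (f (n - k)) := rfl

theorem coeff_zero (Θ : ℂ → E →L[ℂ] E) : coeff Θ 0 = Θ 0 := by
  simp [coeff]

theorem toeplitz_unilateralShift (hΘ : IsContractiveAnalytic Θ) (f : HardySpace E) :
    toeplitz hΘ (unilateralShift E f) = unilateralShift E (toeplitz hΘ f) := by
  ext n
  cases n with
  | zero => simp [toeplitz_apply]
  | succ n =>
    rw [toeplitz_apply, unilateralShift_apply_succ, Finset.sum_range_succ]
    simp only [Nat.sub_self, unilateralShift_apply_zero, map_zero, add_zero]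
    refine Finset.sum_congr rfl fun k hk => ?_
    rw [Finset.mem_range] at hk
    rw [show n + 1 - k = (n - k) + 1 by omega, unilateralShift_apply_succ]

theorem toeplitz_single (hΘ : IsContractiveAnalytic Θ) (x : E) (n : ℕ) :
    toeplitz hΘ (lp.single 2 0 x) n = coeff Θ n x := by
  rw [toeplitz_apply, Finset.sum_eq_single n]
  · simp
  · intro k hk hkn
    rw [Finset.mem_range] at hk
    rw [lp.single_apply_ne _ _ _ (by omega), map_zero]
  · simp

theorem norm_defect_sq (hΘ : IsContractiveAnalytic Θ) (f : LaurentSpace E) :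
    ‖defect hΘ f‖ ^ 2 = ‖f‖ ^ 2 - ‖laurent hΘ f‖ ^ 2 := by
  have hsa := adjoint_defectOperator (laurent hΘ)
  rw [← defect] at hsa
  apply Complex.ofReal_injective
  push_cast
  have h (y : LaurentSpace E) : (‖y‖ : ℂ) ^ 2 = ⟪y, y⟫_ℂ := (inner_self_eq_norm_sq_to_K y).symm
  rw [h, h, h, ← ContinuousLinearMap.adjoint_inner_right, hsa,
    ← mul_apply_eq_comp, defect_mul_self, sub_apply, inner_sub_right,
    one_apply_eq_self, mul_apply_eq_comp, ContinuousLinearMap.adjoint_inner_right]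

theorem norm_defect_hardyInclusion_sq (hΘ : IsContractiveAnalytic Θ) (f : HardySpace E) :
    ‖defect hΘ (hardyInclusion E f)‖ ^ 2 = ‖f‖ ^ 2 - ‖toeplitz hΘ f‖ ^ 2 := by
  rw [norm_defect_sq, laurent_hardyInclusion, norm_hardyInclusion, norm_hardyInclusion]

/-- Together with `bilateralShift_mem` this makes multiplication by `ζ` invertible on the defect
space, so that `W₀` is unitary on the second summand. -/
theorem translate_neg_one_mem (hΘ : IsContractiveAnalytic Θ) {f : LaurentSpace E}
    (hf : f ∈ defectSpace hΘ) : translate E (-1) f ∈ defectSpace hΘ := by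
  refine map_mem_closure (translate E (-1)).continuous hf ?_
  rintro _ ⟨g, rfl⟩
  exact ⟨translate E (-1) g, congrArg (fun T => T g) (defect_commute_translate hΘ (-1)).eq⟩

/-- Multiplication by `ζ⁻¹` on the defect space. -/
noncomputable def defectShiftInv (hΘ : IsContractiveAnalytic Θ) :
    defectSpace hΘ →L[ℂ] defectSpace hΘ :=
  (translate E (-1)).restrict fun _ hf => translate_neg_one_mem hΘ hf

theorem defectShift_defectShiftInv (hΘ : IsContractiveAnalytic Θ) (f : defectSpace hΘ) :
    defectShift hΘ (defectShiftInv hΘ f) = f := by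
  apply Subtype.ext
  change translate E 1 (translate E (-1) (f : LaurentSpace E)) = f
  rw [← ContinuousLinearMap.comp_apply, translate_comp_translate, add_neg_cancel, translate_zero,
    one_apply_eq_self]

@[simp] theorem modelW₀_fst (hΘ : IsContractiveAnalytic Θ) (p : ModelSpace hΘ) :
    (modelW₀ hΘ p).fst = unilateralShift E p.fst := rfl

@[simp] theorem modelW₀_snd (hΘ : IsContractiveAnalytic Θ) (p : ModelSpace hΘ) (n : ℕ) :
    (modelW₀ hΘ p).snd n = defectShift hΘ (p.snd n) := rfl

@[simp] theorem modelW₁_fst (hΘ : IsContractiveAnalytic Θ) (p : ModelSpace hΘ) :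
    (modelW₁ hΘ p).fst = toeplitz hΘ p.fst := rfl

theorem modelW₁_snd (hΘ : IsContractiveAnalytic Θ) (p : ModelSpace hΘ) :
    (modelW₁ hΘ p).snd =
      lp.single 2 0 ⟨defect hΘ (hardyInclusion E p.fst), defect_mem hΘ _⟩ +
        unilateralShift (defectSpace hΘ) p.snd := rfl

theorem modelW₁_snd_zero (hΘ : IsContractiveAnalytic Θ) (p : ModelSpace hΘ) :
    ((modelW₁ hΘ p).snd 0 : LaurentSpace E) = defect hΘ (hardyInclusion E p.fst) := by
  simp [modelW₁_snd]

@[simp] theorem modelW₁_snd_succ (hΘ : IsContractiveAnalytic Θ) (p : ModelSpace hΘ) (n : ℕ) :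
    (modelW₁ hΘ p).snd (n + 1) = p.snd n := by
  simp [modelW₁_snd]

theorem norm_modelW₀ (hΘ : IsContractiveAnalytic Θ) (p : ModelSpace hΘ) :
    ‖modelW₀ hΘ p‖ = ‖p‖ := by
  have h : ‖(modelW₀ hΘ p).snd‖ = ‖p.snd‖ :=
    norm_coefficientwise (defectShift hΘ) (fun g => norm_translate 1 (g : LaurentSpace E)) p.snd
  rw [WithLp.prod_norm_eq_of_L2, WithLp.prod_norm_eq_of_L2, h, modelW₀_fst, norm_unilateralShift]

theorem norm_modelW₁ (hΘ : IsContractiveAnalytic Θ) (p : ModelSpace hΘ) :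
    ‖modelW₁ hΘ p‖ = ‖p‖ := by
  have h : ‖(modelW₁ hΘ p).snd‖ ^ 2 = ‖p.fst‖ ^ 2 - ‖toeplitz hΘ p.fst‖ ^ 2 + ‖p.snd‖ ^ 2 := by
    refine (hasSum_norm_sq _).unique ?_
    rw [← hasSum_nat_add_iff' 1]
    rw [Finset.sum_range_one, Submodule.coe_norm, modelW₁_snd_zero, norm_defect_hardyInclusion_sq,
      add_sub_cancel_left]
    simpa using hasSum_norm_sq p.snd
  rw [WithLp.prod_norm_eq_of_L2, WithLp.prod_norm_eq_of_L2, h, modelW₁_fst]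
  congr 1
  ring

/-- Only the coefficient of `w⁰` in the second component needs `D`: there the claim is that `D`
commutes with multiplication by `ζ`. -/
theorem modelW₁_modelW₀ (hΘ : IsContractiveAnalytic Θ) (p : ModelSpace hΘ) :
    modelW₁ hΘ (modelW₀ hΘ p) = modelW₀ hΘ (modelW₁ hΘ p) := by
  apply WithLp.ofLp_injective
  refine Prod.ext (toeplitz_unilateralShift hΘ p.fst) (lp.ext (funext fun n => ?_))
  change (modelW₁ hΘ (modelW₀ hΘ p)).snd n = (modelW₀ hΘ (modelW₁ hΘ p)).snd n
  cases n with
  | zero =>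
    apply Subtype.ext
    rw [modelW₁_snd_zero, modelW₀_fst, hardyInclusion_unilateralShift, modelW₀_snd]
    change _ = translate E 1 ((modelW₁ hΘ p).snd 0 : LaurentSpace E)
    rw [modelW₁_snd_zero]
    exact congrArg (fun T => T (hardyInclusion E p.fst)) (defect_commute_translate hΘ 1).eq
  | succ n => rw [modelW₁_snd_succ, modelW₀_snd, modelW₀_snd, modelW₁_snd_succ]

theorem modelW₁_injective (hΘ : IsContractiveAnalytic Θ) : Function.Injective (modelW₁ hΘ) :=
  (AddMonoidHomClass.isometry_of_norm _ (norm_modelW₁ hΘ)).injective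

/-- The constant `x ∈ E` as an element of the model space. -/
noncomputable def modelConst (hΘ : IsContractiveAnalytic Θ) (x : E) : ModelSpace hΘ :=
  WithLp.toLp 2 (lp.single 2 0 x, 0)

@[simp] theorem modelConst_fst (hΘ : IsContractiveAnalytic Θ) (x : E) :
    (modelConst hΘ x).fst = lp.single 2 0 x := rfl

@[simp] theorem modelConst_snd (hΘ : IsContractiveAnalytic Θ) (x : E) :
    (modelConst hΘ x).snd = 0 := rfl

theorem norm_modelConst (hΘ : IsContractiveAnalytic Θ) (x : E) : ‖modelConst hΘ x‖ = ‖x‖ := by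
  rw [WithLp.prod_norm_eq_of_L2, modelConst_fst, modelConst_snd, lp.norm_single (by norm_num)]
  simp

theorem inner_modelConst_modelW₀ (hΘ : IsContractiveAnalytic Θ) (x : E) (p : ModelSpace hΘ) :
    ⟪modelConst hΘ x, modelW₀ hΘ p⟫_ℂ = 0 := by
  rw [WithLp.prod_inner_apply]
  change ⟪lp.single 2 0 x, unilateralShift E p.fst⟫_ℂ + ⟪(0 : HardySpace (defectSpace hΘ)), _⟫_ℂ = 0
  rw [lp.inner_single_left]
  simp

/-- With `inner_modelConst_modelW₀` this is the orthogonal splitting of the model space into the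
range of `W₀` and the constants. The witness is `W₀* p`: the backward shift on `H²(E)`, and `ζ⁻¹` on
the second summand. -/
theorem exists_modelW₀_add_modelConst (hΘ : IsContractiveAnalytic Θ) (p : ModelSpace hΘ) :
    ∃ q : ModelSpace hΘ, modelW₀ hΘ q + modelConst hΘ (p.fst 0) = p := by
  refine ⟨WithLp.toLp 2 (backwardShift E p.fst, coefficientwise (defectShiftInv hΘ)
    (fun g => norm_translate_apply_le (-1) (g : LaurentSpace E)) p.snd), ?_⟩
  apply WithLp.ofLp_injective
  refine Prod.ext (unilateralShift_backwardShift p.fst) (lp.ext (funext fun n => ?_))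
  change defectShift hΘ (defectShiftInv hΘ (p.snd n)) + 0 = p.snd n
  rw [add_zero, defectShift_defectShiftInv]

end Model

/-! ### Reducing subspaces of the model, and those on which `W₁` is onto. -/

section ReducingSubspaces

variable {E : Type*} [NormedAddCommGroup E] [InnerProductSpace ℂ E] [CompleteSpace E]
  {Θ : ℂ → E →L[ℂ] E} {hΘ : IsContractiveAnalytic Θ} {M : Submodule ℂ (ModelSpace hΘ)}

theorem IsReducing.modelW₀_mem (hM : IsReducing (model hΘ) M) {p : ModelSpace hΘ} (hp : p ∈ M) :
    modelW₀ hΘ p ∈ M :=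
  hM.invariant 0 p hp

theorem IsReducing.modelW₁_mem (hM : IsReducing (model hΘ) M) {p : ModelSpace hΘ} (hp : p ∈ M) :
    modelW₁ hΘ p ∈ M :=
  hM.invariant 1 p hp

/-- This is the invariance of `M` under `W₀*`, stated without adjoints. For `r ∈ Mᗮ` also `W₀ r ∈
Mᗮ`, and `⟪r, q⟫ = ⟪W₀ r, W₀ q⟫ = ⟪W₀ r, W₀ q + x⟫ = 0`. -/
theorem IsReducing.mem_of_modelW₀_add_modelConst (hM : IsReducing (model hΘ) M)
    {q : ModelSpace hΘ} {x : E} (h : modelW₀ hΘ q + modelConst hΘ x ∈ M) : q ∈ M := by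
  have : CompleteSpace M := hM.isClosed.completeSpace_coe
  rw [← Submodule.orthogonal_orthogonal M, Submodule.mem_orthogonal]
  intro r hr
  have h1 : ⟪modelW₀ hΘ r, modelW₀ hΘ q + modelConst hΘ x⟫_ℂ = 0 :=
    Submodule.inner_left_of_mem_orthogonal h (hM.invariant_orthogonal 0 r hr)
  rwa [inner_add_right, inner_eq_zero_symm.1 (inner_modelConst_modelW₀ hΘ x r), add_zero,
    inner_map_map_of_norm_map (norm_modelW₀ hΘ)] at h1

theorem IsReducing.exists_modelW₀_add_modelConst (hM : IsReducing (model hΘ) M)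
    {p : ModelSpace hΘ} (hp : p ∈ M) :
    ∃ q ∈ M, modelW₀ hΘ q + modelConst hΘ (p.fst 0) = p := by
  obtain ⟨q, hq⟩ := BiIsometry.exists_modelW₀_add_modelConst hΘ p
  exact ⟨q, hM.mem_of_modelW₀_add_modelConst (hq.symm ▸ hp), hq⟩

/-- The projection `I - W₀ W₀*` onto the constants preserves `M`; applied after `n` backward steps
`W₀*`, it extracts the coefficient of `zⁿ`. -/
theorem IsReducing.modelConst_mem (hM : IsReducing (model hΘ) M) {p : ModelSpace hΘ}
    (hp : p ∈ M) (n : ℕ) : modelConst hΘ (p.fst n) ∈ M := by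
  induction n generalizing p with
  | zero =>
    obtain ⟨q, hqM, hq⟩ := hM.exists_modelW₀_add_modelConst hp
    rw [← eq_sub_iff_add_eq'] at hq
    rw [hq]
    exact M.sub_mem hp (hM.modelW₀_mem hqM)
  | succ n ih =>
    obtain ⟨q, hqM, hq⟩ := hM.exists_modelW₀_add_modelConst hp
    have h : p.fst (n + 1) = q.fst n := by
      rw [← hq]
      simp
    exact h ▸ ih hqM

theorem IsReducing.single_mem (hM : IsReducing (model hΘ) M) {x : E}
    (hx : modelConst hΘ x ∈ M) (n : ℕ) :
    (WithLp.toLp 2 (lp.single 2 n x, 0) : ModelSpace hΘ) ∈ M := by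
  induction n with
  | zero => exact hx
  | succ n ih =>
    convert hM.modelW₀_mem ih using 1
    apply WithLp.ofLp_injective
    refine Prod.ext (lp.ext (funext fun m => ?_)) (lp.ext (funext fun m => ?_))
    · change lp.single (E := fun _ : ℕ => E) 2 (n + 1) x m = unilateralShift E (lp.single 2 n x) m
      cases m with
      | zero => simp
      | succ m => simp [Pi.single_apply]
    · exact (map_zero (defectShift hΘ)).symm

theorem toLp_fst_mem_of_single_mem {M : Submodule ℂ (ModelSpace hΘ)}
    (hM : IsClosed (M : Set (ModelSpace hΘ))) (f : HardySpace E)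
    (hf : ∀ n, (WithLp.toLp 2 (lp.single 2 n (f n), 0) : ModelSpace hΘ) ∈ M) :
    (WithLp.toLp 2 (f, 0) : ModelSpace hΘ) ∈ M := by
  let J : HardySpace E →L[ℂ] ModelSpace hΘ :=
    (WithLp.prodContinuousLinearEquiv 2 ℂ (HardySpace E)
      (HardySpace (defectSpace hΘ))).symm.toContinuousLinearMap ∘L ContinuousLinearMap.inl ℂ _ _
  have h : HasSum (fun n => J (lp.single 2 n (f n))) (J f) :=
    J.hasSum (lp.hasSum_single (by norm_num) f)
  exact hM.mem_of_tendsto h (Filter.Eventually.of_forall fun s => M.sum_mem fun n _ => hf n)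

/-- The shift part and the unitary part of `W₀` split every reducing subspace. -/
theorem IsReducing.toLp_snd_mem (hM : IsReducing (model hΘ) M) {p : ModelSpace hΘ}
    (hp : p ∈ M) : (WithLp.toLp 2 (0, p.snd) : ModelSpace hΘ) ∈ M := by
  have h := M.sub_mem hp (toLp_fst_mem_of_single_mem hM.isClosed p.fst
    fun n => hM.single_mem (hM.modelConst_mem hp n) n)
  convert h using 1
  apply WithLp.ofLp_injective
  exact Prod.ext (sub_self p.fst).symm (sub_zero p.snd).symm

/-- One step of an infinite descent. As `W₁ q` has no constant part, it equals `W₀ p` with `p ∈ M`.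
Writing `p = W₁ q'` and commuting gives `W₁ q = W₁ W₀ q'`, and injectivity of `W₁` gives `q = W₀
q'`, where `q'` satisfies the same hypotheses as `q`. -/
theorem IsReducing.exists_modelW₀_of_modelW₁_fst_eq_zero (hM : IsReducing (model hΘ) M)
    (hs : ∀ y ∈ M, ∃ x ∈ M, modelW₁ hΘ x = y) {q : ModelSpace hΘ} (hq : q ∈ M)
    (h0 : (modelW₁ hΘ q).fst = 0) :
    ∃ q' ∈ M, (modelW₁ hΘ q').fst = 0 ∧ modelW₀ hΘ q' = q := by
  obtain ⟨p, hp, h⟩ := hM.exists_modelW₀_add_modelConst (hM.modelW₁_mem hq)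
  have hc : modelConst hΘ ((modelW₁ hΘ q).fst 0) = 0 := by
    rw [h0]
    apply WithLp.ofLp_injective
    exact Prod.ext (lp.single_zero 2 0) rfl
  rw [hc, add_zero] at h
  obtain ⟨q', hq', rfl⟩ := hs p hp
  rw [← modelW₁_modelW₀] at h
  have hqq := modelW₁_injective hΘ h
  refine ⟨q', hq', lp.ext (funext fun k => ?_), hqq⟩
  rw [← hqq, modelW₁_modelW₀, modelW₀_fst] at h0
  simpa using congrArg (fun f : HardySpace E => f (k + 1)) h0

/-- By the descent `q` is divisible by every power of `W₀`, hence its first component by every power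
of `z`. -/
theorem IsReducing.fst_eq_zero_of_modelW₁_fst_eq_zero (hM : IsReducing (model hΘ) M)
    (hs : ∀ y ∈ M, ∃ x ∈ M, modelW₁ hΘ x = y) (n : ℕ) {q : ModelSpace hΘ} (hq : q ∈ M)
    (h0 : (modelW₁ hΘ q).fst = 0) : q.fst n = 0 := by
  induction n generalizing q with
  | zero =>
    obtain ⟨q', -, -, rfl⟩ := hM.exists_modelW₀_of_modelW₁_fst_eq_zero hs hq h0
    rfl
  | succ n ih =>
    obtain ⟨q', hq', h0', rfl⟩ := hM.exists_modelW₀_of_modelW₁_fst_eq_zero hs hq h0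
    exact ih hq' h0'

/-- A preimage `q` of `p` under `W₁` again has zero first component. The coefficient of `w⁰` in `p`
is then `D 0 = 0`, and each later one is the preceding coefficient of `q`. -/
theorem IsReducing.snd_eq_zero_of_fst_eq_zero (hM : IsReducing (model hΘ) M)
    (hs : ∀ y ∈ M, ∃ x ∈ M, modelW₁ hΘ x = y) (n : ℕ) {p : ModelSpace hΘ} (hp : p ∈ M)
    (h0 : p.fst = 0) : p.snd n = 0 := by
  induction n generalizing p with
  | zero =>
    obtain ⟨q, hq, rfl⟩ := hs p hp
    apply Subtype.ext
    have hq0 : q.fst = 0 :=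
      lp.ext (funext fun k => hM.fst_eq_zero_of_modelW₁_fst_eq_zero hs k hq h0)
    rw [modelW₁_snd_zero, hq0, map_zero, map_zero]
    rfl
  | succ n ih =>
    obtain ⟨q, hq, rfl⟩ := hs p hp
    rw [modelW₁_snd_succ]
    exact ih hq (lp.ext (funext fun k => hM.fst_eq_zero_of_modelW₁_fst_eq_zero hs k hq h0))

theorem IsReducing.snd_eq_zero (hM : IsReducing (model hΘ) M)
    (hs : ∀ y ∈ M, ∃ x ∈ M, modelW₁ hΘ x = y) {p : ModelSpace hΘ} (hp : p ∈ M) : p.snd = 0 :=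
  by
  refine lp.ext (funext fun n => ?_)
  exact hM.snd_eq_zero_of_fst_eq_zero hs n (p := WithLp.toLp 2 (0, p.snd)) (hM.toLp_snd_mem hp) rfl

/-- Split `W₁ x = W₀ r + Θ(0)x` with `r ∈ M`, and write `r = W₁ r'`. Then `W₀ r = W₁ W₀ r'` is
orthogonal to `W₁ x`, because `W₀ r'` is orthogonal to `x`. Hence `‖W₀ r‖² = 0`. -/
theorem IsReducing.modelW₁_modelConst (hM : IsReducing (model hΘ) M)
    (hs : ∀ y ∈ M, ∃ x ∈ M, modelW₁ hΘ x = y) {x : E} (hx : modelConst hΘ x ∈ M) :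
    modelW₁ hΘ (modelConst hΘ x) = modelConst hΘ (Θ 0 x) := by
  obtain ⟨r, hr, h⟩ := hM.exists_modelW₀_add_modelConst (hM.modelW₁_mem hx)
  rw [modelW₁_fst, modelConst_fst, toeplitz_single, coeff_zero] at h
  obtain ⟨r', -, rfl⟩ := hs r hr
  have h1 : ⟪modelW₀ hΘ (modelW₁ hΘ r'), modelW₁ hΘ (modelConst hΘ x)⟫_ℂ = 0 := by
    rw [← modelW₁_modelW₀, inner_map_map_of_norm_map (norm_modelW₁ hΘ)]
    exact inner_eq_zero_symm.1 (inner_modelConst_modelW₀ hΘ x r')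
  rw [← h, inner_add_right, inner_eq_zero_symm.1 (inner_modelConst_modelW₀ hΘ _ _), add_zero,
    inner_self_eq_zero] at h1
  rw [← h, h1, zero_add]

theorem IsReducing.norm_apply_of_modelConst_mem (hM : IsReducing (model hΘ) M)
    (hs : ∀ y ∈ M, ∃ x ∈ M, modelW₁ hΘ x = y) {x : E} (hx : modelConst hΘ x ∈ M) :
    ‖Θ 0 x‖ = ‖x‖ := by
  rw [← norm_modelConst hΘ x, ← norm_modelW₁ hΘ, hM.modelW₁_modelConst hs hx, norm_modelConst]

theorem IsReducing.coeff_apply_of_modelConst_mem (hM : IsReducing (model hΘ) M)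
    (hs : ∀ y ∈ M, ∃ x ∈ M, modelW₁ hΘ x = y) {x : E} (hx : modelConst hΘ x ∈ M) {k : ℕ}
    (hk : k ≠ 0) : coeff Θ k x = 0 := by
  rw [← toeplitz_single hΘ, ← modelConst_fst hΘ, ← modelW₁_fst, hM.modelW₁_modelConst hs hx]
  exact lp.single_apply_ne _ _ _ hk

/-- The preimage `q` of the constant `y` is itself constant: its part `W₀ q'` is orthogonal to `q`,
since `W₁ W₀ q' = W₀ W₁ q'` is orthogonal to `y = W₁ q`. -/
theorem IsReducing.exists_modelConst_mem_apply_eq (hM : IsReducing (model hΘ) M)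
    (hs : ∀ y ∈ M, ∃ x ∈ M, modelW₁ hΘ x = y) {y : E} (hy : modelConst hΘ y ∈ M) :
    ∃ x, modelConst hΘ x ∈ M ∧ Θ 0 x = y := by
  obtain ⟨q, hq, hqy⟩ := hs _ hy
  obtain ⟨q', -, h⟩ := hM.exists_modelW₀_add_modelConst hq
  refine ⟨q.fst 0, hM.modelConst_mem hq 0, ?_⟩
  have h1 : ⟪modelW₀ hΘ q', q⟫_ℂ = 0 := by
    rw [← inner_map_map_of_norm_map (norm_modelW₁ hΘ), hqy, modelW₁_modelW₀]
    exact inner_eq_zero_symm.1 (inner_modelConst_modelW₀ hΘ _ _)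
  rw [← h, inner_add_right, inner_eq_zero_symm.1 (inner_modelConst_modelW₀ hΘ _ _), add_zero,
    inner_self_eq_zero] at h1
  rw [h1, zero_add] at h
  rw [← h] at hqy
  have h2 := congrArg (fun p : ModelSpace hΘ => p.fst 0) hqy
  simpa [toeplitz_single, coeff_zero] using h2

end ReducingSubspaces

/-! ### Rigidity of the Taylor coefficients where `Θ(0)` or its adjoint preserves norms. -/

section Coefficients

variable {E : Type*} [NormedAddCommGroup E] [InnerProductSpace ℂ E] [CompleteSpace E]
  {Θ : ℂ → E →L[ℂ] E}

/-- `T_Θ` maps the constant `x` to the sequence `Θ_j x`, so `‖Θ_0 x‖² + ‖Θ_k x‖² ≤ ‖x‖²`, and the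
first term already exhausts the bound. -/
theorem IsContractiveAnalytic.coeff_apply_eq_zero (hΘ : IsContractiveAnalytic Θ) {x : E}
    (hx : ‖Θ 0 x‖ = ‖x‖) {k : ℕ} (hk : k ≠ 0) : coeff Θ k x = 0 := by
  have h1 := sum_norm_sq_le (toeplitz hΘ (lp.single 2 0 x)) {0, k}
  have h2 : ‖toeplitz hΘ (lp.single 2 0 x)‖ ≤ ‖x‖ := by
    rw [← lp.norm_single (E := fun _ : ℕ => E) (p := 2) (by norm_num) 0 x]
    exact norm_ofCoords_apply_le _ _ _
  have h3 := pow_le_pow_left₀ (norm_nonneg _) h2 2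
  rw [Finset.sum_pair hk.symm, toeplitz_single, toeplitz_single, coeff_zero, hx] at h1
  exact norm_eq_zero.1 (pow_eq_zero_iff two_ne_zero |>.1 (le_antisymm (by linarith) (by positivity)))

/-- The dual statement: the row `(Θ_0, Θ_k)` is a contraction, hence so is the column of adjoints,
and `‖Θ_0* x‖² + ‖Θ_k* x‖² ≤ ‖x‖²`. -/
theorem IsContractiveAnalytic.adjoint_coeff_apply_eq_zero (hΘ : IsContractiveAnalytic Θ) {x : E}
    (hx : ‖ContinuousLinearMap.adjoint (Θ 0) x‖ = ‖x‖) {k : ℕ} (hk : k ≠ 0) :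
    ContinuousLinearMap.adjoint (coeff Θ k) x = 0 := by
  let y : ℕ → E := fun j => ContinuousLinearMap.adjoint (coeff Θ j) x
  have h1 := hΘ.norm_sum_sq_le y {0, k}
  set v := ∑ j ∈ ({0, k} : Finset ℕ), coeff Θ j (y j) with hv
  have h2 : ⟪v, x⟫_ℂ = ((∑ j ∈ ({0, k} : Finset ℕ), ‖y j‖ ^ 2 : ℝ) : ℂ) := by
    rw [hv, sum_inner]
    push_cast
    refine Finset.sum_congr rfl fun j _ => ?_
    rw [← ContinuousLinearMap.adjoint_inner_right]
    exact inner_self_eq_norm_sq_to_K (y j)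
  have h3 := norm_inner_le_norm (𝕜 := ℂ) v x
  rw [h2, Complex.norm_real, Real.norm_of_nonneg (Finset.sum_nonneg fun _ _ => by positivity)] at h3
  have h0 : ‖y 0‖ = ‖x‖ := by simpa only [y, coeff_zero] using hx
  rw [Finset.sum_pair hk.symm, h0] at h1 h3
  -- Both bounds compare with `∑ ‖y j‖² = ⟪v, x⟫`: the row contraction from below, Cauchy-Schwarz
  -- from above.
  have h4 : ‖v‖ ^ 2 ≤ ‖v‖ * ‖x‖ := h1.trans h3
  have h5 : ‖v‖ ≤ ‖x‖ := by
    rcases (norm_nonneg v).eq_or_lt with h | h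
    · rw [← h]; exact norm_nonneg x
    · rw [sq] at h4
      exact le_of_mul_le_mul_left h4 h
  have h6 := mul_le_mul_of_nonneg_right h5 (norm_nonneg x)
  exact norm_eq_zero.1 (pow_eq_zero_iff two_ne_zero |>.1
    (le_antisymm (show ‖y k‖ ^ 2 ≤ 0 by nlinarith) (by positivity)))

theorem IsContractiveAnalytic.norm_zero_le_one (hΘ : IsContractiveAnalytic Θ) : ‖Θ 0‖ ≤ 1 :=
  hΘ.norm_le_one 0 (by simp)

theorem toeplitz_apply_of_norm_eq (hΘ : IsContractiveAnalytic Θ) {f : HardySpace E}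
    (hf : ∀ n, ‖Θ 0 (f n)‖ = ‖f n‖) (n : ℕ) : toeplitz hΘ f n = Θ 0 (f n) := by
  rw [toeplitz_apply, Finset.sum_eq_single 0]
  · rw [coeff_zero, Nat.sub_zero]
  · intro k _ hk
    exact hΘ.coeff_apply_eq_zero (hf _) hk
  · simp

theorem defect_hardyInclusion_of_norm_eq (hΘ : IsContractiveAnalytic Θ) {f : HardySpace E}
    (hf : ∀ n, ‖Θ 0 (f n)‖ = ‖f n‖) : defect hΘ (hardyInclusion E f) = 0 := by
  have h : ‖toeplitz hΘ f‖ ^ 2 = ‖f‖ ^ 2 := by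
    refine (hasSum_norm_sq _).unique ?_
    simpa only [toeplitz_apply_of_norm_eq hΘ hf, hf] using hasSum_norm_sq f
  have h1 := norm_defect_hardyInclusion_sq hΘ f
  rw [h, sub_self] at h1
  exact norm_eq_zero.1 (pow_eq_zero_iff two_ne_zero |>.1 h1)

theorem modelW₁_toLp_of_norm_eq (hΘ : IsContractiveAnalytic Θ) {f g : HardySpace E}
    (hf : ∀ n, ‖Θ 0 (f n)‖ = ‖f n‖) (hg : ∀ n, Θ 0 (f n) = g n) :
    modelW₁ hΘ (WithLp.toLp 2 (f, 0)) = WithLp.toLp 2 (g, 0) := by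
  apply WithLp.ofLp_injective
  refine Prod.ext (lp.ext (funext fun n => (toeplitz_apply_of_norm_eq hΘ hf n).trans (hg n)))
    (lp.ext (funext fun n => ?_))
  change (modelW₁ hΘ (WithLp.toLp 2 (f, 0))).snd n = 0
  cases n with
  | zero =>
    apply Subtype.ext
    rw [modelW₁_snd_zero]
    exact defect_hardyInclusion_of_norm_eq hΘ hf
  | succ n => rw [modelW₁_snd_succ]; rfl

theorem norm_adjoint_apply_zero_le (hΘ : IsContractiveAnalytic Θ) (x : E) :
    ‖ContinuousLinearMap.adjoint (Θ 0) x‖ ≤ ‖x‖ := by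
  simpa using (ContinuousLinearMap.adjoint (Θ 0)).le_of_opNorm_le
    ((LinearIsometryEquiv.norm_map ContinuousLinearMap.adjoint (Θ 0)).trans_le
      hΘ.norm_zero_le_one) x

/-- The preimage is taken coefficientwise by `Θ(0)*`, which inverts `Θ(0)` on `N`; being a
contraction, it keeps the sequence square summable. -/
theorem exists_modelW₁_toLp_eq (hΘ : IsContractiveAnalytic Θ) {N : Submodule ℂ E}
    (hn : ∀ x ∈ N, ‖Θ 0 x‖ = ‖x‖) (hs : ∀ y ∈ N, ∃ x ∈ N, Θ 0 x = y) {g : HardySpace E}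
    (hg : ∀ n, g n ∈ N) :
    ∃ f : HardySpace E, (∀ n, f n ∈ N) ∧
      modelW₁ hΘ (WithLp.toLp 2 (f, 0)) = WithLp.toLp 2 (g, 0) := by
  have h : ∀ y ∈ N, ContinuousLinearMap.adjoint (Θ 0) y ∈ N ∧
      Θ 0 (ContinuousLinearMap.adjoint (Θ 0) y) = y := by
    intro y hy
    obtain ⟨x, hx, rfl⟩ := hs y hy
    rw [adjoint_apply_apply_of_norm_eq hΘ.norm_zero_le_one (hn x hx)]
    exact ⟨hx, rfl⟩
  refine ⟨coefficientwise (ContinuousLinearMap.adjoint (Θ 0)) (norm_adjoint_apply_zero_le hΘ) g,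
    fun n => (h _ (hg n)).1, modelW₁_toLp_of_norm_eq hΘ (fun n => hn _ (h _ (hg n)).1)
      fun n => (h _ (hg n)).2⟩

end Coefficients

/-! ### The reducing subspace `H²(N) ⊕ 0`. -/

section Hardy

variable {E : Type*} [NormedAddCommGroup E] [InnerProductSpace ℂ E] [CompleteSpace E]
  {Θ : ℂ → E →L[ℂ] E}

/-- The subspace `H²(N) ⊕ 0` of the model space. -/
noncomputable def hardySubspace (hΘ : IsContractiveAnalytic Θ) (N : Submodule ℂ E) :
    Submodule ℂ (ModelSpace hΘ) where
  carrier := {p | (∀ n, p.fst n ∈ N) ∧ p.snd = 0}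
  add_mem' := fun {p q} hp hq => ⟨fun n => N.add_mem (hp.1 n) (hq.1 n), by simp [hp.2, hq.2]⟩
  zero_mem' := ⟨fun _ => N.zero_mem, rfl⟩
  smul_mem' := fun c p hp => ⟨fun n => N.smul_mem c (hp.1 n), by simp [hp.2]⟩

theorem mem_hardySubspace {hΘ : IsContractiveAnalytic Θ} {N : Submodule ℂ E}
    {p : ModelSpace hΘ} : p ∈ hardySubspace hΘ N ↔ (∀ n, p.fst n ∈ N) ∧ p.snd = 0 :=
  Iff.rfl

theorem isClosed_hardySubspace (hΘ : IsContractiveAnalytic Θ) {N : Submodule ℂ E}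
    (hN : IsClosed (N : Set E)) : IsClosed (hardySubspace hΘ N : Set (ModelSpace hΘ)) := by
  have h1 (n : ℕ) : Continuous fun p : ModelSpace hΘ => p.fst n :=
    (lp.evalCLM ℂ (fun _ : ℕ => E) 2 n).continuous.comp
      (WithLp.prod_continuous_ofLp 2 _ _).fst
  have h2 : Continuous fun p : ModelSpace hΘ => p.snd := (WithLp.prod_continuous_ofLp 2 _ _).snd
  have h3 : (hardySubspace hΘ N : Set (ModelSpace hΘ)) =
      (⋂ n, (fun p : ModelSpace hΘ => p.fst n) ⁻¹' N) ∩ (fun p => p.snd) ⁻¹' {0} := by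
    ext p
    simp [mem_hardySubspace]
  rw [h3]
  exact (isClosed_iInter fun n => hN.preimage (h1 n)).inter (isClosed_singleton.preimage h2)

theorem mem_orthogonal_hardySubspace {hΘ : IsContractiveAnalytic Θ} {N : Submodule ℂ E}
    {p : ModelSpace hΘ} : p ∈ (hardySubspace hΘ N)ᗮ ↔ ∀ n, p.fst n ∈ Nᗮ := by
  rw [Submodule.mem_orthogonal]
  constructor
  · intro h n
    rw [Submodule.mem_orthogonal]
    intro y hy
    have h1 := h (WithLp.toLp 2 (lp.single 2 n y, 0)) ⟨fun m => ?_, rfl⟩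
    · rw [WithLp.prod_inner_apply] at h1
      change ⟪lp.single 2 n y, p.fst⟫_ℂ + ⟪(0 : HardySpace (defectSpace hΘ)), _⟫_ℂ = 0 at h1
      rwa [lp.inner_single_left, inner_zero_left, add_zero] at h1
    · change lp.single (E := fun _ : ℕ => E) 2 n y m ∈ N
      rw [lp.single_apply, Pi.single_apply]
      split_ifs
      exacts [hy, N.zero_mem]
  · intro h q hq
    rw [WithLp.prod_inner_apply]
    change ⟪q.fst, p.fst⟫_ℂ + ⟪q.snd, p.snd⟫_ℂ = 0
    rw [hq.2, inner_zero_left, add_zero, lp.inner_eq_tsum]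
    simp [Submodule.inner_right_of_mem_orthogonal (hq.1 _) (h _)]

theorem isReducing_hardySubspace (hΘ : IsContractiveAnalytic Θ) {N : Submodule ℂ E}
    (hN : IsReducing (fun _ : Unit => Θ 0) N) (hn : ∀ x ∈ N, ‖Θ 0 x‖ = ‖x‖)
    (hs : ∀ y ∈ N, ∃ x ∈ N, Θ 0 x = y) : IsReducing (model hΘ) (hardySubspace hΘ N) where
  isClosed := isClosed_hardySubspace hΘ hN.isClosed
  invariant := by
    refine Fin.forall_fin_two.2 ⟨fun p hp => ⟨fun n => ?_, lp.ext (funext fun n => ?_)⟩,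
      fun p hp => ?_⟩
    · change unilateralShift E p.fst n ∈ N
      cases n with
      | zero => exact N.zero_mem
      | succ n => exact hp.1 n
    · change defectShift hΘ (p.snd n) = 0
      rw [hp.2]
      exact map_zero _
    · have h : p = WithLp.toLp 2 (p.fst, 0) := WithLp.ofLp_injective _ (Prod.ext rfl hp.2)
      have hT := toeplitz_apply_of_norm_eq hΘ (f := p.fst) fun n => hn _ (hp.1 n)
      change modelW₁ hΘ p ∈ hardySubspace hΘ N
      rw [h, modelW₁_toLp_of_norm_eq hΘ (fun n => hn _ (hp.1 n)) fun n => (hT n).symm]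
      refine ⟨fun n => ?_, rfl⟩
      change toeplitz hΘ p.fst n ∈ N
      rw [hT]
      exact hN.invariant () _ (hp.1 n)
  invariant_orthogonal := by
    refine Fin.forall_fin_two.2 ⟨fun p hp => ?_, fun p hp => ?_⟩
    · rw [mem_orthogonal_hardySubspace] at hp ⊢
      intro n
      change unilateralShift E p.fst n ∈ Nᗮ
      cases n with
      | zero => exact Nᗮ.zero_mem
      | succ n => exact hp n
    · rw [mem_orthogonal_hardySubspace] at hp ⊢
      intro n
      change toeplitz hΘ p.fst n ∈ Nᗮ
      rw [toeplitz_apply]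
      refine Nᗮ.sum_mem fun k _ => ?_
      rcases eq_or_ne k 0 with rfl | hk
      · rw [coeff_zero]
        exact hN.invariant_orthogonal () _ (hp _)
      · rw [Submodule.mem_orthogonal]
        intro y hy
        obtain ⟨x, hx, rfl⟩ := hs y hy
        -- For `y = Θ(0)x` with `x ∈ N`, `Θ(0)* y = x` has the norm of `y`, so `Θ_k* y = 0` and the
        -- range of `Θ_k` is orthogonal to `y`.
        rw [← ContinuousLinearMap.adjoint_inner_left, hΘ.adjoint_coeff_apply_eq_zero _ hk,
          inner_zero_left]
        rw [adjoint_apply_apply_of_norm_eq hΘ.norm_zero_le_one (hn x hx), hn x hx]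

end Hardy

/-! ### The two equivalences. -/

section Main

variable {E : Type*} [NormedAddCommGroup E] [InnerProductSpace ℂ E] [CompleteSpace E]
  {Θ : ℂ → E →L[ℂ] E}

theorem isReducing_top {H I : Type*} [NormedAddCommGroup H] [InnerProductSpace ℂ H]
    (V : I → H →L[ℂ] H) : IsReducing V ⊤ where
  isClosed := isClosed_univ
  invariant := fun _ _ _ => trivial
  invariant_orthogonal := fun i x hx => by
    rw [Submodule.top_orthogonal_eq_bot, Submodule.mem_bot] at hx ⊢
    rw [hx, map_zero]

/-- An isometric `Θ(0)` kills all higher coefficients, so `L_Θ` is isometric on all of `L²(E)`; then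
`D = 0` and the defect space is zero. -/
theorem snd_eq_zero_of_forall_norm_eq (hΘ : IsContractiveAnalytic Θ)
    (hn : ∀ x, ‖Θ 0 x‖ = ‖x‖) (p : ModelSpace hΘ) : p.snd = 0 := by
  have hD : defect hΘ = 0 := by
    ext1 f
    have h : ‖laurent hΘ f‖ ^ 2 = ‖f‖ ^ 2 := by
      refine (hasSum_norm_sq _).unique ?_
      convert hasSum_norm_sq f using 3 with n
      rw [laurent_apply, tsum_eq_single 0 fun k hk => hΘ.coeff_apply_eq_zero (hn _) hk, coeff_zero,
        hn]
      simp
    have h1 := norm_defect_sq hΘ f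
    rw [h, sub_self] at h1
    exact norm_eq_zero.1 (pow_eq_zero_iff two_ne_zero |>.1 h1)
  refine lp.ext (funext fun n => Subtype.ext ?_)
  have h := (p.snd n).2
  have hbot : defectSpace hΘ = ⊥ := by
    rw [defectSpace, hD]
    change (LinearMap.range (0 : LaurentSpace E →ₗ[ℂ] LaurentSpace E)).topologicalClosure = ⊥
    rw [LinearMap.range_zero]
    exact IsClosed.submodule_topologicalClosure_eq isClosed_singleton
  exact (Submodule.mem_bot ℂ).1 (hbot ▸ h)

theorem modelW₁_mem_unitary_iff (hΘ : IsContractiveAnalytic Θ) :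
    modelW₁ hΘ ∈ unitary (ModelSpace hΘ →L[ℂ] ModelSpace hΘ) ↔
      (∀ z ∈ Metric.ball (0 : ℂ) 1, Θ z = Θ 0) ∧ Θ 0 ∈ unitary (E →L[ℂ] E) := by
  rw [mem_unitary_iff_norm_map_surjective, mem_unitary_iff_norm_map_surjective]
  constructor
  · rintro ⟨-, h⟩
    have hM := isReducing_top (model hΘ)
    have hs : ∀ y ∈ (⊤ : Submodule ℂ (ModelSpace hΘ)), ∃ x ∈ (⊤ : Submodule ℂ (ModelSpace hΘ)),
        modelW₁ hΘ x = y := fun y _ => (h y).imp fun x hx => ⟨trivial, hx⟩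
    refine ⟨fun z hz => ?_, fun x => hM.norm_apply_of_modelConst_mem hs trivial, fun y => ?_⟩
    · refine (hΘ.hasSum_coeff (by simpa using hz)).unique ?_
      have h1 : ∀ k ≠ 0, z ^ k • coeff Θ k = 0 := fun k hk => by
        rw [show coeff Θ k = 0 from ContinuousLinearMap.ext fun x =>
          hM.coeff_apply_of_modelConst_mem hs trivial hk, smul_zero]
      simpa [coeff_zero] using hasSum_single 0 h1
    · obtain ⟨x, -, hx⟩ := hM.exists_modelConst_mem_apply_eq hs (y := y) trivial
      exact ⟨x, hx⟩
  · rintro ⟨-, hn, hs⟩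
    refine ⟨norm_modelW₁ hΘ, fun p => ?_⟩
    obtain ⟨f, -, hf⟩ := exists_modelW₁_toLp_eq hΘ (N := ⊤) (fun x _ => hn x)
      (fun y _ => (hs y).imp fun x hx => ⟨trivial, hx⟩) (g := p.fst) fun _ => trivial
    exact ⟨_, hf.trans
      (WithLp.ofLp_injective _ (Prod.ext rfl (snd_eq_zero_of_forall_norm_eq hΘ hn p).symm))⟩

theorem isPure_of_isCompletelyNonunitary (hΘ : IsContractiveAnalytic Θ)
    (h : IsCompletelyNonunitary (Θ 0)) : IsPure {1} (model hΘ) := by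
  intro M hM hne
  have : CompleteSpace M := hM.isClosed.completeSpace_coe
  rw [isUnitaryOn_restrict_iff]
  intro hU
  have hs : ∀ y ∈ M, ∃ x ∈ M, modelW₁ hΘ x = y := (hU 1 rfl).2
  -- `J` is `modelConst` as a linear map, so `M.comap J` is the space of constants in `M`.
  let J : E →ₗ[ℂ] ModelSpace hΘ := (WithLp.linearEquiv 2 ℂ _).symm.toLinearMap ∘ₗ
    LinearMap.inl ℂ _ _ ∘ₗ lp.lsingle (𝕜 := ℂ) (E := fun _ : ℕ => E) 2 0
  have hJ : Continuous J := AddMonoidHomClass.continuous_of_bound J 1 fun x => by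
    rw [one_mul]
    exact (norm_modelConst hΘ x).le
  have hN : IsReducing (fun _ : Unit => Θ 0) (M.comap J) :=
    { isClosed := hM.isClosed.preimage hJ
      invariant := fun _ x hx => by
        change modelConst hΘ (Θ 0 x) ∈ M
        rw [← hM.modelW₁_modelConst hs hx]
        exact hM.modelW₁_mem hx
      invariant_orthogonal := fun _ x hx => by
        -- The constant coefficients of elements of `M` all lie in `M.comap J`, so a constant
        -- orthogonal to that space is orthogonal to `M`. Applying `W₁` and testing against
        -- constants brings this back to `Θ(0)x`.
        have h1 : modelConst hΘ x ∈ Mᗮ := by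
          rw [Submodule.mem_orthogonal]
          intro p hp
          rw [WithLp.prod_inner_apply]
          change ⟪p.fst, lp.single 2 0 x⟫_ℂ + ⟪p.snd, 0⟫_ℂ = 0
          rw [lp.inner_single_right, inner_zero_right, add_zero]
          exact (Submodule.mem_orthogonal _ _).1 hx _ (hM.modelConst_mem hp 0)
        have h2 : modelW₁ hΘ (modelConst hΘ x) ∈ Mᗮ := hM.invariant_orthogonal 1 _ h1
        rw [Submodule.mem_orthogonal]
        intro y hy
        have h3 := (Submodule.mem_orthogonal _ _).1 h2 (modelConst hΘ y) hy
        rw [WithLp.prod_inner_apply] at h3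
        change ⟪lp.single 2 0 y, toeplitz hΘ (lp.single 2 0 x)⟫_ℂ +
          ⟪(0 : HardySpace (defectSpace hΘ)), _⟫_ℂ = 0 at h3
        rwa [inner_zero_left, add_zero, lp.inner_single_left, toeplitz_single, coeff_zero] at h3 }
  refine h (M.comap J) hN ?_ ?_
  -- If `M` contained no nonzero constant, every coefficient of `p.fst` would vanish, and `p.snd`
  -- vanishes in any case.
  · obtain ⟨p, hp, hp0⟩ := M.ne_bot_iff.1 hne
    intro hbot
    refine hp0 (WithLp.ofLp_injective _ (Prod.ext (lp.ext (funext fun n => ?_))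
      (hM.snd_eq_zero hs hp)))
    have h1 : p.fst n ∈ M.comap J := hM.modelConst_mem hp n
    rwa [hbot, Submodule.mem_bot] at h1
  · have : CompleteSpace (M.comap J) := hN.isClosed.completeSpace_coe
    refine (isUnitaryOn_restrict_iff hN _).2 fun _ _ =>
      ⟨fun x hx => hM.norm_apply_of_modelConst_mem hs hx,
        fun y hy => hM.exists_modelConst_mem_apply_eq hs hy⟩

theorem isCompletelyNonunitary_of_isPure (hΘ : IsContractiveAnalytic Θ)
    (h : IsPure {1} (model hΘ)) : IsCompletelyNonunitary (Θ 0) := by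
  intro N hN hne
  have : CompleteSpace N := hN.isClosed.completeSpace_coe
  rw [isUnitaryOn_restrict_iff]
  intro hU
  obtain ⟨hn, hs⟩ := hU () trivial
  have hM := isReducing_hardySubspace hΘ hN hn hs
  refine h _ hM ?_ ?_
  · obtain ⟨x, hx, hx0⟩ := N.ne_bot_iff.1 hne
    refine (Submodule.ne_bot_iff _).2 ⟨modelConst hΘ x, ⟨fun n => ?_, rfl⟩, fun h0 => hx0 ?_⟩
    · rw [modelConst_fst, lp.single_apply, Pi.single_apply]
      split_ifs
      exacts [hx, N.zero_mem]
    · rw [← norm_eq_zero, ← norm_modelConst hΘ, h0, norm_zero]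
  · have : CompleteSpace (hardySubspace hΘ N) := hM.isClosed.completeSpace_coe
    refine (isUnitaryOn_restrict_iff hM _).2 ?_
    rintro _ rfl
    refine ⟨fun p _ => norm_modelW₁ hΘ p, fun p hp => ?_⟩
    obtain ⟨f, hf, hfp⟩ := exists_modelW₁_toLp_eq hΘ hn hs hp.1
    exact ⟨WithLp.toLp 2 (f, 0), ⟨hf, rfl⟩, hfp.trans (WithLp.ofLp_injective _ (Prod.ext rfl hp.2.symm))⟩

end Main

end BiIsometry

theorem proposition5p3 {E : Type*} [NormedAddCommGroup E] [InnerProductSpace ℂ E]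
    [CompleteSpace E] (Θ : ℂ → E →L[ℂ] E) (hΘ : BiIsometry.IsContractiveAnalytic Θ) :
    (BiIsometry.model hΘ 1 ∈ unitary (BiIsometry.ModelSpace hΘ →L[ℂ] BiIsometry.ModelSpace hΘ) ↔
      (∀ z ∈ Metric.ball (0 : ℂ) 1, Θ z = Θ 0) ∧ Θ 0 ∈ unitary (E →L[ℂ] E)) ∧
    (BiIsometry.IsPure {1} (BiIsometry.model hΘ) ↔
      BiIsometry.IsCompletelyNonunitary (Θ 0)) :=
  ⟨BiIsometry.modelW₁_mem_unitary_iff hΘ,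
    BiIsometry.isCompletelyNonunitary_of_isPure hΘ,
    BiIsometry.isPure_of_isCompletelyNonunitary hΘ⟩
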